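/- Let $q$ be a real-valued $C^\infty$ function on an open neighborhood of $[0,1]$, and consider the Dirichlet eigenvalue problem $$-y''+q\,y=\lambda\,y \ \text{ in } ]0,1[,\qquad y(0)=y(1)=0 .$$ Let $n\ge 1$, let $\lambda_1<\dots<\lambda_n$ be its $n$ lowest eigenvalues, and for $1\le i\le n$ let $h_i$ be a (nontrivial, real) eigenfunction associated with $\lambda_i$; write $\vec h=(h_1,\dots,h_n)$ and $\vec h^{(m)}=(h_1^{(m)},\dots,h_n^{(m)})$ for the $m$-th derivatives. Let $\vec b\in\mathbb R^n\setminus\{0\}$ and $S_{\vec b}=\sum_{j=1}^n b_j h_j$. Then $S_{\vec b}$ has finitely many zeros $\bar c_1<\dots<\bar c_p$ in $]0,1[$ (possibly $p=0$), and at each $\bar c_j$ it vanishes at some finite order $k_j$, i.e. $S_{\vec b}^{(m)}(\bar c_j)=0$ for $0\le m<k_j$ and $S_{\vec b}^{(k_j)}(\bar c_j)\ne 0$. Moreover: 1. $k_1+\dots+k_p\le n-1$. 2. If $k_1+\dots+k_p=n-1$, then there is a constant $C\neq 0$ such that, for all $x\in[0,1]$, $$S_{\vec b}(x)=C\,\left|\vec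 h(\bar c_1)\ \vec h'(\bar c_1)\dots\vec h^{(k_1-1)}(\bar c_1)\ \dots\ \vec h(\bar c_p)\dots\vec h^{(k_p-1)}(\bar c_p)\ \vec h(x)\right| ,$$ the determinant of the $n\times n$ matrix with the indicated columns. -/

import Mathlib

open scoped ContDiff

namespace SturmLiouville

/-- `y` is a (real, nontrivial) eigenfunction, with eigenvalue `lam`, of the Dirichlet problem
`-y'' + q y = lam y` in `]0,1[`, `y 0 = y 1 = 0`. It is continuous up to the boundary and twice
differentiable in `]0,1[`; its values outside `[0,1]` are irrelevant. -/
structure IsDirichletEigenfunction (q : ℝ → ℝ) (lam : ℝ) (y : ℝ → ℝ) : Prop where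
  continuousOn : ContinuousOn y (Set.Icc 0 1)
  differentiableAt : ∀ x ∈ Set.Ioo (0 : ℝ) 1, DifferentiableAt ℝ y x
  differentiableAt_deriv : ∀ x ∈ Set.Ioo (0 : ℝ) 1, DifferentiableAt ℝ (deriv y) x
  equation : ∀ x ∈ Set.Ioo (0 : ℝ) 1, -deriv (deriv y) x + q x * y x = lam * y x
  boundary_zero : y 0 = 0
  boundary_one : y 1 = 0
  nontrivial : ∃ x ∈ Set.Ioo (0 : ℝ) 1, y x ≠ 0

/-- `lam` is an eigenvalue of the Dirichlet problem with potential `q`. -/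
def IsDirichletEigenvalue (q : ℝ → ℝ) (lam : ℝ) : Prop :=
  ∃ y : ℝ → ℝ, IsDirichletEigenfunction q lam y

/-- `lam 0 < ⋯ < lam (n-1)` are the `n` lowest Dirichlet eigenvalues: every other eigenvalue is
larger than all of them. -/
structure AreFirstEigenvalues (q : ℝ → ℝ) {n : ℕ} (lam : Fin n → ℝ) : Prop where
  strictMono : StrictMono lam
  isEigenvalue : ∀ i, IsDirichletEigenvalue q (lam i)
  lowest : ∀ μ : ℝ, IsDirichletEigenvalue q μ → μ ∈ Set.range lam ∨ ∀ i, lam i < μ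

/-- The linear combination `S_b = ∑ j, b j * h j`. -/
def linComb {n : ℕ} (h : Fin n → ℝ → ℝ) (b : Fin n → ℝ) (x : ℝ) : ℝ :=
  ∑ j, b j * h j x

/-- `f` vanishes at `c` at order exactly `k`. -/
def HasVanishingOrder (f : ℝ → ℝ) (c : ℝ) (k : ℕ) : Prop :=
  (∀ m < k, iteratedDeriv m f c = 0) ∧ iteratedDeriv k f c ≠ 0

/-- The columns of the confluent Slater determinant, from left to right:
`h(c 0), h'(c 0), …, h^{(k 0 - 1)}(c 0), h(c 1), …, h^{(k (p-1) - 1)}(c (p-1))`, and finally `h(x)`.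
The equivalence `finSigmaFinEquiv` enumerates the pairs (point, order of derivation)
lexicographically. -/
noncomputable def slaterColumn {n p : ℕ} (h : Fin n → ℝ → ℝ) (c : Fin p → ℝ) (k : Fin p → ℕ)
    (x : ℝ) : Fin (∑ j, k j + 1) → Fin n → ℝ :=
  Fin.snoc (α := fun _ => Fin n → ℝ)
    (fun l i => iteratedDeriv (finSigmaFinEquiv.symm l).2 (h i) (c (finSigmaFinEquiv.symm l).1))
    (fun i => h i x)

/-- The confluent Slater determinant
`|h(c 0) … h^{(k 0 - 1)}(c 0) … h(c (p-1)) … h^{(k (p-1) - 1)}(c (p-1)) h(x)|`, an `n × n`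
determinant when `k 0 + ⋯ + k (p-1) = n - 1`. -/
noncomputable def confluentSlater {n p : ℕ} (h : Fin n → ℝ → ℝ) (c : Fin p → ℝ) (k : Fin p → ℕ)
    (hk : ∑ j, k j + 1 = n) (x : ℝ) : ℝ :=
  Matrix.det (Matrix.of fun i l : Fin n => slaterColumn h c k x (Fin.cast hk.symm l) i)

end SturmLiouville

/-! The heart is one count, `hasZeros_linComb_lt`: a nontrivial combination of the first `n`
eigenfunctions has fewer than `n` zeros in `]0,1[`, with multiplicity. The argument goes back to
Liouville. Index from 0, let `u = h_0`, which has no interior zero, and `S = ∑ b_j h_j`. Rolle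
applied to `S/u` costs one zero; the Wronskian `w = u S' - u' S = u² (S/u)'` gains two, at 0 and 1;
Rolle applied to `w` costs one. Since `w' = u ∑ (λ_0 - λ_j) b_j h_j`, replacing `b_j` by `(λ_0 -
λ_j) b_j` loses no zero. Iterated and normalised, the coefficients concentrate on the largest `J`
with `b_J ≠ 0`, so the combinations tend in `C¹` to a function whose zeros are simple, namely `h_J`,
and `S` has at most as many zeros as `h_J`.

That `h_J` has at most `J` interior zeros (`AreFirstEigenvalues.card_zeros_le`) is Sturm's
oscillation bound, by shooting from 0: the zero count starts at 0 for very negative `λ` and can grow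
only when a zero enters through 1, that is, past an eigenvalue.

For the determinant, the count shows that `n - 1` vanishing conditions fix the coefficients up to a
factor, and the cofactors of the last column satisfy the same conditions. -/

namespace SturmLiouville

open Set Filter Topology

/-! ### First order system and uniqueness of its solutions -/

/-- `(y, z)` solves the first order system `y' = z`, `z' = (q - lam) y` on `[0,1]`. -/
structure IsSolutionPair (q : ℝ → ℝ) (lam : ℝ) (y z : ℝ → ℝ) : Prop where
  hasDerivAt_fst : ∀ x ∈ Icc (0 : ℝ) 1, HasDerivAt y (z x) x
  hasDerivAt_snd : ∀ x ∈ Icc (0 : ℝ) 1, HasDerivAt z ((q x - lam) * y x) x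

namespace IsSolutionPair

variable {q : ℝ → ℝ} {lam : ℝ} {y z : ℝ → ℝ}

lemma continuousOn_fst (h : IsSolutionPair q lam y z) : ContinuousOn y (Icc 0 1) :=
  fun x hx => (h.hasDerivAt_fst x hx).continuousAt.continuousWithinAt

lemma continuousOn_snd (h : IsSolutionPair q lam y z) : ContinuousOn z (Icc 0 1) :=
  fun x hx => (h.hasDerivAt_snd x hx).continuousAt.continuousWithinAt

lemma sub_smul {y₁ z₁ : ℝ → ℝ} (h : IsSolutionPair q lam y z) (h₁ : IsSolutionPair q lam y₁ z₁)
    (a : ℝ) : IsSolutionPair q lam (fun x => y x - a * y₁ x) (fun x => z x - a * z₁ x) where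
  hasDerivAt_fst x hx := (h.hasDerivAt_fst x hx).sub ((h₁.hasDerivAt_fst x hx).const_mul a)
  hasDerivAt_snd x hx :=
    ((h.hasDerivAt_snd x hx).sub ((h₁.hasDerivAt_snd x hx).const_mul a)).congr_deriv (by ring)

/-- A solution with a double zero vanishes identically. -/
lemma eq_zero_of_double_zero (h : IsSolutionPair q lam y z) (hq : ContinuousOn q (Icc 0 1))
    {x₀ : ℝ} (hx₀ : x₀ ∈ Icc (0 : ℝ) 1) (hy : y x₀ = 0) (hz : z x₀ = 0) :
    ∀ x ∈ Icc (0 : ℝ) 1, y x = 0 ∧ z x = 0 := by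
  -- Gronwall in both directions: the energy `E = y² + z²` satisfies `|E'| ≤ (1 + K) E`, so `E
  -- e^{(1+K)x}` increases and `E e^{-(1+K)x}` decreases.
  obtain ⟨K, hK⟩ := isCompact_Icc.exists_bound_of_continuousOn (hq.sub (continuousOn_const (c := lam)))
  have hK' : ∀ x ∈ Icc (0 : ℝ) 1, |2 * y x * z x * (1 + (q x - lam))|
      ≤ (1 + K) * (y x ^ 2 + z x ^ 2) := by
    intro x hx
    have h1 : |1 + (q x - lam)| ≤ 1 + K := by
      have := hK x hx
      rw [Real.norm_eq_abs] at this
      exact (abs_add_le _ _).trans (by simpa using this)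
    rw [abs_mul, mul_comm (1 + K)]
    refine mul_le_mul ?_ h1 (abs_nonneg _) (by positivity)
    rw [abs_le]
    constructor <;> nlinarith [sq_nonneg (y x + z x), sq_nonneg (y x - z x)]
  have hE : ∀ a : ℝ, ∀ x ∈ Icc (0 : ℝ) 1,
      HasDerivAt (fun x => (y x ^ 2 + z x ^ 2) * Real.exp (a * x))
        ((2 * y x * z x * (1 + (q x - lam)) + a * (y x ^ 2 + z x ^ 2)) * Real.exp (a * x)) x := by
    intro a x hx
    have h1 := ((h.hasDerivAt_fst x hx).pow 2).add ((h.hasDerivAt_snd x hx).pow 2)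
    have h2 := ((hasDerivAt_id x).const_mul a).exp
    refine (h1.mul h2).congr_deriv ?_
    simp only [Pi.add_apply, Pi.pow_apply, id]
    push_cast
    ring
  have hcont : ∀ a : ℝ, ContinuousOn (fun x => (y x ^ 2 + z x ^ 2) * Real.exp (a * x)) (Icc 0 1) :=
    fun a x hx => (hE a x hx).continuousAt.continuousWithinAt
  have hmono : MonotoneOn (fun x => (y x ^ 2 + z x ^ 2) * Real.exp ((1 + K) * x)) (Icc 0 1) := by
    refine monotoneOn_of_hasDerivWithinAt_nonneg (convex_Icc 0 1) (hcont _)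
      (fun x hx => (hE _ x (interior_subset hx)).hasDerivWithinAt) fun x hx => ?_
    have := abs_le.1 (hK' x (interior_subset hx))
    exact mul_nonneg (by linarith [this.1]) (Real.exp_pos _).le
  have hanti : AntitoneOn (fun x => (y x ^ 2 + z x ^ 2) * Real.exp (-(1 + K) * x)) (Icc 0 1) := by
    refine antitoneOn_of_hasDerivWithinAt_nonpos (convex_Icc 0 1) (hcont _)
      (fun x hx => (hE _ x (interior_subset hx)).hasDerivWithinAt) fun x hx => ?_
    have := abs_le.1 (hK' x (interior_subset hx))
    exact mul_nonpos_of_nonpos_of_nonneg (by linarith [this.2]) (Real.exp_pos _).le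
  intro x hx
  have hle : y x ^ 2 + z x ^ 2 ≤ 0 := by
    rcases le_total x x₀ with hxx | hxx
    · have := hmono hx hx₀ hxx
      simp only [hy, hz] at this
      exact nonpos_of_mul_nonpos_left (by simpa using this) (Real.exp_pos _)
    · have := hanti hx₀ hx hxx
      simp only [hy, hz] at this
      exact nonpos_of_mul_nonpos_left (by simpa using this) (Real.exp_pos _)
  constructor <;> nlinarith [sq_nonneg (y x), sq_nonneg (z x)]

end IsSolutionPair

/-- A Dirichlet eigenfunction agrees on `[0,1]` with a solution of the first order system that is
differentiable up to the boundary. -/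
lemma IsDirichletEigenfunction.exists_isSolutionPair {q : ℝ → ℝ} {lam : ℝ} {y : ℝ → ℝ}
    (hy : IsDirichletEigenfunction q lam y) (hq : ContinuousOn q (Icc 0 1)) :
    ∃ Y Z : ℝ → ℝ, IsSolutionPair q lam Y Z ∧ EqOn Y y (Icc 0 1) := by
  have h01 : (0 : ℝ) ≤ 1 := zero_le_one
  have hF : ContinuousOn (fun x => (q x - lam) * y x) (Icc 0 1) :=
    (hq.sub continuousOn_const).mul hy.continuousOn
  -- Extending by constants outside `[0,1]` gives the primitives two-sided derivatives at the
  -- endpoints. Integration starts at `1/2`, since nothing is known of `deriv y` at 0.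
  set r : ℝ → ℝ := IccExtend h01 ((Icc (0 : ℝ) 1).domRestrict fun x => (q x - lam) * y x) with hr
  have hrc : Continuous r := (continuousOn_iff_continuous_domRestrict.1 hF).Icc_extend'
  have hrx : ∀ x ∈ Icc (0 : ℝ) 1, r x = (q x - lam) * y x := fun x hx => by
    rw [hr, IccExtend_of_mem _ _ hx, domRestrict_apply]
  set Z : ℝ → ℝ := fun x => deriv y (1 / 2) + ∫ t in (1 / 2 : ℝ)..x, r t
  have hZ : ∀ x, HasDerivAt Z (r x) x := fun x =>
    (intervalIntegral.integral_hasDerivAt_right (hrc.intervalIntegrable _ _)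
      hrc.stronglyMeasurable.stronglyMeasurableAtFilter hrc.continuousAt).const_add _
  have hZc : Continuous Z := continuous_iff_continuousAt.2 fun x => (hZ x).continuousAt
  set Y : ℝ → ℝ := fun x => y (1 / 2) + ∫ t in (1 / 2 : ℝ)..x, Z t
  have hY : ∀ x, HasDerivAt Y (Z x) x := fun x =>
    (intervalIntegral.integral_hasDerivAt_right (hZc.intervalIntegrable _ _)
      hZc.stronglyMeasurable.stronglyMeasurableAtFilter hZc.continuousAt).const_add _
  have hmid : (1 / 2 : ℝ) ∈ Ioo (0 : ℝ) 1 := by norm_num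
  have hyZ : EqOn (deriv y) Z (Ioo 0 1) := by
    refine isOpen_Ioo.eqOn_of_deriv_eq isPreconnected_Ioo
      (fun x hx => (hy.differentiableAt_deriv x hx).differentiableWithinAt)
      (fun x _ => (hZ x).differentiableAt.differentiableWithinAt) (fun x hx => ?_) hmid (by simp [Z])
    rw [(hZ x).deriv, hrx x (Ioo_subset_Icc_self hx)]
    linarith [hy.equation x hx]
  have hYy : EqOn Y y (Ioo 0 1) := by
    refine isOpen_Ioo.eqOn_of_deriv_eq isPreconnected_Ioo
      (fun x _ => (hY x).differentiableAt.differentiableWithinAt)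
      (fun x hx => (hy.differentiableAt x hx).differentiableWithinAt) (fun x hx => ?_) hmid
      (by simp [Y])
    rw [(hY x).deriv, hyZ hx]
  have hYc : Continuous Y := continuous_iff_continuousAt.2 fun x => (hY x).continuousAt
  have hYy' : EqOn Y y (Icc 0 1) :=
    hYy.of_subset_closure hYc.continuousOn hy.continuousOn Ioo_subset_Icc_self
      (closure_Ioo (zero_ne_one' ℝ)).ge
  refine ⟨Y, Z, ⟨fun x _ => hY x, fun x hx => ?_⟩, hYy'⟩
  rw [hYy' hx, ← hrx x hx]
  exact hZ x

/-! ### Volterra operator and shooting solutions -/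

/-- The primitive vanishing at `0` of the constant extension to `ℝ` of `u`. -/
noncomputable def primitive (u : C(Icc (0 : ℝ) 1, ℝ)) (x : ℝ) : ℝ :=
  ∫ t in (0 : ℝ)..x, IccExtend (zero_le_one' ℝ) u t

lemma continuous_IccExtend (u : C(Icc (0 : ℝ) 1, ℝ)) :
    Continuous (IccExtend (zero_le_one' ℝ) u) := u.continuous.Icc_extend'

lemma hasDerivAt_primitive (u : C(Icc (0 : ℝ) 1, ℝ)) (x : ℝ) :
    HasDerivAt (primitive u) (IccExtend (zero_le_one' ℝ) u x) x :=
  have hc := continuous_IccExtend u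
  intervalIntegral.integral_hasDerivAt_right (hc.intervalIntegrable _ _)
    hc.stronglyMeasurable.stronglyMeasurableAtFilter hc.continuousAt

lemma continuous_primitive (u : C(Icc (0 : ℝ) 1, ℝ)) : Continuous (primitive u) :=
  continuous_iff_continuousAt.2 fun x => (hasDerivAt_primitive u x).continuousAt

lemma primitive_zero_right (u : C(Icc (0 : ℝ) 1, ℝ)) : primitive u 0 = 0 := by
  simp [primitive]

lemma abs_primitive_le {u : C(Icc (0 : ℝ) 1, ℝ)} {c : ℝ} {n : ℕ}
    (hu : ∀ x : Icc (0 : ℝ) 1, |u x| ≤ c * (x : ℝ) ^ n) (x : Icc (0 : ℝ) 1) :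
    |primitive u x| ≤ c * (x : ℝ) ^ (n + 1) / (n + 1) := by
  have h := intervalIntegral.norm_integral_le_of_norm_le (μ := MeasureTheory.volume)
    (f := IccExtend (zero_le_one' ℝ) u) (g := fun t => c * t ^ n) x.2.1
    (Eventually.of_forall fun t ht => by
      have ht' : t ∈ Icc (0 : ℝ) 1 := ⟨ht.1.le, ht.2.trans x.2.2⟩
      rw [IccExtend_of_mem _ _ ht']
      exact hu ⟨t, ht'⟩)
    (Continuous.intervalIntegrable (by fun_prop) _ _)
  rw [intervalIntegral.integral_const_mul, integral_pow] at h
  simpa [primitive, mul_div_assoc] using h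

/-- Integration from `0` as an operator on continuous functions. -/
noncomputable def primitiveCLM : C(Icc (0 : ℝ) 1, ℝ) →L[ℝ] C(Icc (0 : ℝ) 1, ℝ) :=
  LinearMap.mkContinuous
    { toFun := fun u => ⟨fun x => primitive u x, (continuous_primitive u).comp continuous_subtype_val⟩
      map_add' := fun u v => by
        ext x
        exact intervalIntegral.integral_add ((continuous_IccExtend u).intervalIntegrable _ _)
          ((continuous_IccExtend v).intervalIntegrable _ _)
      map_smul' := fun a u => by
        ext x
        exact intervalIntegral.integral_smul a _ } 1
    (fun u => by
      rw [ContinuousMap.norm_le _ (by positivity)]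
      intro x
      have h := abs_primitive_le (u := u) (c := ‖u‖) (n := 0)
        (fun x => by simpa using u.norm_coe_le_norm x) x
      have hx : (x : ℝ) ≤ 1 := x.2.2
      have : ‖u‖ * (x : ℝ) ≤ ‖u‖ * 1 := by gcongr
      simp only [zero_add, pow_one, Nat.cast_zero, div_one] at h
      rw [one_mul]
      exact h.trans (this.trans (mul_one _).le))

/-- The Volterra operator `u ↦ ∫₀ˣ ∫₀ˢ a u`. -/
noncomputable def volterra (a : C(Icc (0 : ℝ) 1, ℝ)) :
    C(Icc (0 : ℝ) 1, ℝ) →L[ℝ] C(Icc (0 : ℝ) 1, ℝ) :=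
  primitiveCLM * (primitiveCLM * ContinuousLinearMap.mul ℝ _ a)

lemma volterra_apply (a u : C(Icc (0 : ℝ) 1, ℝ)) :
    volterra a u = primitiveCLM (primitiveCLM (a * u)) := rfl

/-- The factor `x ^ n` is what produces the factorial upon integration. Each step integrates twice,
but the gain of one integration is enough and the other is discarded. -/
lemma abs_volterra_pow_apply_le (a u : C(Icc (0 : ℝ) 1, ℝ)) (n : ℕ) (x : Icc (0 : ℝ) 1) :
    |(volterra a ^ n) u x| ≤ ‖a‖ ^ n / n.factorial * ‖u‖ * (x : ℝ) ^ n := by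
  induction n generalizing x with
  | zero => simpa using u.norm_coe_le_norm x
  | succ n ih =>
    rw [pow_succ', mul_apply_eq_comp, volterra_apply]
    have hbound : ∀ x : Icc (0 : ℝ) 1, |(a * (volterra a ^ n) u) x| ≤
        ‖a‖ * (‖a‖ ^ n / n.factorial * ‖u‖) * (x : ℝ) ^ n := fun x => by
      rw [ContinuousMap.mul_apply, abs_mul, mul_assoc]
      exact mul_le_mul (a.norm_coe_le_norm x) (ih x) (abs_nonneg _) (norm_nonneg _)
    have h1 := abs_primitive_le hbound
    have h2 : ∀ x : Icc (0 : ℝ) 1, |primitiveCLM (a * (volterra a ^ n) u) x| ≤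
        ‖a‖ ^ (n + 1) / (n + 1).factorial * ‖u‖ * (n + 1) * (x : ℝ) ^ n := fun x => by
      refine (h1 x).trans ?_
      have hx0 : 0 ≤ (x : ℝ) := x.2.1
      have hx : (x : ℝ) ^ (n + 1) ≤ (x : ℝ) ^ n := pow_le_pow_of_le_one hx0 x.2.2 (Nat.le_succ n)
      have hC : 0 ≤ ‖a‖ ^ (n + 1) / n.factorial * ‖u‖ := by positivity
      calc ‖a‖ * (‖a‖ ^ n / n.factorial * ‖u‖) * (x : ℝ) ^ (n + 1) / (n + 1)
          ≤ ‖a‖ * (‖a‖ ^ n / n.factorial * ‖u‖) * (x : ℝ) ^ (n + 1) :=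
            div_le_self (by positivity) (by linarith [n.cast_nonneg (α := ℝ)])
        _ = ‖a‖ ^ (n + 1) / n.factorial * ‖u‖ * (x : ℝ) ^ (n + 1) := by ring
        _ ≤ ‖a‖ ^ (n + 1) / n.factorial * ‖u‖ * (x : ℝ) ^ n := by gcongr
        _ = _ := by
            rw [Nat.factorial_succ]
            push_cast
            field_simp
    refine (abs_primitive_le h2 x).trans_eq ?_
    field_simp

/-- Some power `V ^ n` has norm below 1, so `1 - V ^ n` is a unit, and `1 - V` is one of its two
commuting factors. -/
lemma isUnit_one_sub_volterra (a : C(Icc (0 : ℝ) 1, ℝ)) : IsUnit (1 - volterra a) := by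
  obtain ⟨n, hn⟩ := ((FloorSemiring.tendsto_pow_div_factorial_atTop ‖a‖).eventually
    (gt_mem_nhds zero_lt_one)).exists
  have hnorm : ‖volterra a ^ n‖ < 1 := by
    refine lt_of_le_of_lt (ContinuousLinearMap.opNorm_le_bound _ (by positivity) fun u => ?_) hn
    rw [ContinuousMap.norm_le _ (by positivity)]
    intro x
    refine (abs_volterra_pow_apply_le a u n x).trans ?_
    have hx : (x : ℝ) ^ n ≤ 1 := pow_le_one₀ x.2.1 x.2.2
    exact mul_le_of_le_one_right (by positivity) hx
  have h : IsUnit (1 - volterra a ^ n) := isUnit_one_sub_of_norm_lt_one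
    (R := C(Icc (0 : ℝ) 1, ℝ) →L[ℝ] C(Icc (0 : ℝ) 1, ℝ)) hnorm
  rw [← mul_neg_geom_sum] at h
  refine (Commute.isUnit_mul_iff ?_).1 h |>.1
  rw [Commute, SemiconjBy, mul_neg_geom_sum, geom_sum_mul_neg]

/-- The solutions `φ lam` of `φ'' = (q - lam) φ`, `φ 0 = 0`, `φ' 0 = 1` exist and depend
continuously on `lam`, together with their derivatives `ψ lam`. -/
theorem exists_shooting_solution {q : ℝ → ℝ} (hq : ContinuousOn q (Icc 0 1)) :
    ∃ φ ψ : ℝ → ℝ → ℝ,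
      (∀ lam, IsSolutionPair q lam (φ lam) (ψ lam) ∧ φ lam 0 = 0 ∧ ψ lam 0 = 1) ∧
      (∀ lam, ∀ x ∈ Icc (0 : ℝ) 1,
        Tendsto (fun p : ℝ × ℝ => φ p.1 p.2) (𝓝 lam ×ˢ 𝓝[Icc 0 1] x) (𝓝 (φ lam x))) ∧
      (∀ lam, ∀ x ∈ Icc (0 : ℝ) 1,
        Tendsto (fun p : ℝ × ℝ => ψ p.1 p.2) (𝓝 lam ×ˢ 𝓝[Icc 0 1] x) (𝓝 (ψ lam x))) := by
  let Q : C(Icc (0 : ℝ) 1, ℝ) := ⟨_, continuousOn_iff_continuous_domRestrict.1 hq⟩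
  let a : ℝ → C(Icc (0 : ℝ) 1, ℝ) := fun lam => Q - ContinuousMap.const _ lam
  have ha : Continuous a := by
    refine continuous_const.sub ?_
    exact ContinuousMap.continuous_const'
  -- As `primitiveCLM 1` is the function `x`, this `u` solves the integral equation `u = x + V u`.
  -- Continuity in `lam` comes from that of inversion in the Banach algebra of operators.
  let u : ℝ → C(Icc (0 : ℝ) 1, ℝ) := fun lam => Ring.inverse (1 - volterra (a lam)) (primitiveCLM 1)
  have hV : Continuous fun lam => 1 - volterra (a lam) := by
    unfold volterra
    exact continuous_const.sub (continuous_const.clm_comp (continuous_const.clm_comp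
      ((ContinuousLinearMap.mul ℝ _).continuous.comp ha)))
  have hu : Continuous u := by
    have h1 : Continuous fun lam => Ring.inverse (1 - volterra (a lam)) := by
      refine continuous_iff_continuousAt.2 fun lam => ?_
      have h := NormedRing.inverse_continuousAt
        (R := C(Icc (0 : ℝ) 1, ℝ) →L[ℝ] C(Icc (0 : ℝ) 1, ℝ)) (isUnit_one_sub_volterra (a lam)).unit
      exact ContinuousAt.comp (g := Ring.inverse) h hV.continuousAt
    exact h1.clm_apply continuous_const
  let v : ℝ → C(Icc (0 : ℝ) 1, ℝ) := fun lam => 1 + primitiveCLM (a lam * u lam)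
  have hv : Continuous v := continuous_const.add (primitiveCLM.continuous.comp (ha.mul hu))
  have huv : ∀ lam, u lam = primitiveCLM (v lam) := by
    intro lam
    have h : ((1 - volterra (a lam)) * Ring.inverse (1 - volterra (a lam))) (primitiveCLM 1) =
        primitiveCLM 1 := by
      rw [Ring.mul_inverse_cancel _ (isUnit_one_sub_volterra (a lam))]
      rfl
    have h' : u lam - volterra (a lam) (u lam) = primitiveCLM 1 := h
    rw [map_add, ← h', volterra_apply]
    abel
  have heval : ∀ w : ℝ → C(Icc (0 : ℝ) 1, ℝ), Continuous w → ∀ f : ℝ → ℝ → ℝ,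
      (∀ lam, ∀ x, ∀ hx : x ∈ Icc (0 : ℝ) 1, f lam x = w lam ⟨x, hx⟩) → ∀ lam, ∀ x ∈ Icc (0 : ℝ) 1,
        Tendsto (fun p : ℝ × ℝ => f p.1 p.2) (𝓝 lam ×ˢ 𝓝[Icc 0 1] x) (𝓝 (f lam x)) := by
    intro w hw f hf lam x hx
    have hc : Continuous fun p : ℝ × ℝ => IccExtend (zero_le_one' ℝ) (w p.1) p.2 := by
      have : Continuous fun p : ℝ × ℝ => (w p.1) (projIcc 0 1 (zero_le_one' ℝ) p.2) :=
        (hw.comp continuous_fst).eval (continuous_projIcc.comp continuous_snd)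
      exact this
    have h1 : Tendsto (fun p : ℝ × ℝ => IccExtend (zero_le_one' ℝ) (w p.1) p.2)
        (𝓝 lam ×ˢ 𝓝[Icc 0 1] x) (𝓝 (IccExtend (zero_le_one' ℝ) (w lam) x)) := by
      refine (hc.tendsto (lam, x)).mono_left ?_
      rw [nhds_prod_eq]
      exact Filter.prod_mono le_rfl nhdsWithin_le_nhds
    rw [IccExtend_of_mem _ _ hx, ← hf lam x hx] at h1
    refine h1.congr' ?_
    have : ∀ᶠ p : ℝ × ℝ in 𝓝 lam ×ˢ 𝓝[Icc 0 1] x, p.2 ∈ Icc (0 : ℝ) 1 :=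
      tendsto_snd.eventually self_mem_nhdsWithin
    filter_upwards [this] with p hp
    rw [IccExtend_of_mem _ _ hp, hf _ _ hp]
  refine ⟨fun lam => primitive (v lam), fun lam x => 1 + primitive (a lam * u lam) x,
    fun lam => ⟨⟨fun x hx => ?_, fun x hx => ?_⟩, primitive_zero_right _, ?_⟩, ?_, ?_⟩
  · refine (hasDerivAt_primitive (v lam) x).congr_deriv ?_
    rw [IccExtend_of_mem _ _ hx]
    rfl
  · refine ((hasDerivAt_primitive (a lam * u lam) x).const_add 1).congr_deriv ?_
    rw [IccExtend_of_mem _ _ hx, huv lam]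
    rfl
  · simp [primitive_zero_right]
  · refine heval u hu _ fun lam x hx => ?_
    rw [huv lam]
    rfl
  · exact heval v hv _ fun lam x hx => rfl

/-! ### Stability of zeros under perturbation -/

section Perturbation

variable {ι : Type*} {l : Filter ι} {F F' : ι → ℝ → ℝ} {f f' : ℝ → ℝ}

/-- Functions that are jointly `C¹`-close to a function without double zeros have no double
zeros. -/
lemma eventually_no_double_zero
    (hF : ∀ x ∈ Icc (0 : ℝ) 1, Tendsto (fun p : ι × ℝ => F p.1 p.2) (l ×ˢ 𝓝[Icc 0 1] x) (𝓝 (f x)))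
    (hF' : ∀ x ∈ Icc (0 : ℝ) 1,
      Tendsto (fun p : ι × ℝ => F' p.1 p.2) (l ×ˢ 𝓝[Icc 0 1] x) (𝓝 (f' x)))
    (hf : ∀ x ∈ Icc (0 : ℝ) 1, f x = 0 → f' x ≠ 0) :
    ∀ᶠ i in l, ∀ x ∈ Icc (0 : ℝ) 1, F i x = 0 → F' i x ≠ 0 := by
  by_contra hcon
  rw [not_eventually, frequently_iff_neBot] at hcon
  -- Along an ultrafilter of bad indices, points chosen in `[0,1]` converge by compactness, without
  -- extracting subsequences.
  obtain ⟨U, hU⟩ := Ultrafilter.exists_le (l ⊓ 𝓟 {i | ¬ ∀ x ∈ Icc (0 : ℝ) 1, F i x = 0 → F' i x ≠ 0})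
  have hUl : (U : Filter ι) ≤ l := hU.trans inf_le_left
  have hbad : ∀ᶠ i in (U : Filter ι), ∃ x ∈ Icc (0 : ℝ) 1, F i x = 0 ∧ F' i x = 0 := by
    have : {i | ¬ ∀ x ∈ Icc (0 : ℝ) 1, F i x = 0 → F' i x ≠ 0} ∈ (U : Filter ι) :=
      le_principal_iff.1 (hU.trans inf_le_right)
    filter_upwards [this] with i hi
    simpa [and_assoc] using hi
  obtain ⟨t, ht⟩ := hbad.choice
  have htIcc : ∀ᶠ i in (U : Filter ι), t i ∈ Icc (0 : ℝ) 1 := ht.mono fun i h => h.1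
  obtain ⟨x, hx, hlim⟩ := isCompact_Icc.ultrafilter_le_nhds (U.map t)
    (le_principal_iff.2 htIcc)
  have hpair : Tendsto (fun i => (i, t i)) U (l ×ˢ 𝓝[Icc 0 1] x) :=
    Tendsto.prodMk (tendsto_id.mono_left hUl) (tendsto_nhdsWithin_iff.2 ⟨hlim, htIcc⟩)
  have h0 : f x = 0 := tendsto_nhds_unique ((hF x hx).comp hpair)
    (tendsto_const_nhds.congr' (ht.mono fun i h => h.2.1.symm))
  have h0' : f' x = 0 := tendsto_nhds_unique ((hF' x hx).comp hpair)
    (tendsto_const_nhds.congr' (ht.mono fun i h => h.2.2.symm))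
  exact hf x hx h0 h0'

/-- Functions that are jointly `C¹`-close to a function without double zeros have at most as many
zeros in `[0,1]`. -/
lemma eventually_card_zeros_le
    (hF : ∀ x ∈ Icc (0 : ℝ) 1, Tendsto (fun p : ι × ℝ => F p.1 p.2) (l ×ˢ 𝓝[Icc 0 1] x) (𝓝 (f x)))
    (hF' : ∀ x ∈ Icc (0 : ℝ) 1,
      Tendsto (fun p : ι × ℝ => F' p.1 p.2) (l ×ˢ 𝓝[Icc 0 1] x) (𝓝 (f' x)))
    (hFd : ∀ i, ∀ x ∈ Icc (0 : ℝ) 1, HasDerivAt (F i) (F' i x) x)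
    (hf : ∀ x ∈ Icc (0 : ℝ) 1, f x = 0 → f' x ≠ 0)
    {M : ℕ} (hM : ∀ T : Finset ℝ, (∀ x ∈ T, x ∈ Icc (0 : ℝ) 1 ∧ f x = 0) → T.card ≤ M) :
    ∀ᶠ i in l, ∀ T : Finset ℝ, (∀ x ∈ T, x ∈ Icc (0 : ℝ) 1 ∧ F i x = 0) → T.card ≤ M := by
  by_contra hcon
  rw [not_eventually, frequently_iff_neBot] at hcon
  obtain ⟨U, hU⟩ := Ultrafilter.exists_le (l ⊓ 𝓟 {i | ¬ ∀ T : Finset ℝ,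
    (∀ x ∈ T, x ∈ Icc (0 : ℝ) 1 ∧ F i x = 0) → T.card ≤ M})
  have hUl : (U : Filter ι) ≤ l := hU.trans inf_le_left
  have hbad : ∀ᶠ i in (U : Filter ι), ∃ t : Fin (M + 1) → ℝ, Function.Injective t ∧
      ∀ j, t j ∈ Icc (0 : ℝ) 1 ∧ F i (t j) = 0 := by
    have : {i | ¬ ∀ T : Finset ℝ, (∀ x ∈ T, x ∈ Icc (0 : ℝ) 1 ∧ F i x = 0) → T.card ≤ M} ∈
      (U : Filter ι) := le_principal_iff.1 (hU.trans inf_le_right)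
    filter_upwards [this] with i hi
    simp only [not_forall, not_le] at hi
    obtain ⟨T, hT, hcard⟩ := hi
    obtain ⟨T', hT', hcard'⟩ := Finset.exists_subset_card_eq (Nat.succ_le_of_lt hcard)
    exact ⟨T'.orderEmbOfFin hcard', (T'.orderEmbOfFin hcard').injective,
      fun j => hT _ (hT' (T'.orderEmbOfFin_mem hcard' j))⟩
  obtain ⟨t, ht⟩ := hbad.choice
  have htIcc : ∀ j, ∀ᶠ i in (U : Filter ι), t i j ∈ Icc (0 : ℝ) 1 :=
    fun j => ht.mono fun i h => (h.2 j).1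
  have hlim : ∀ j, ∃ x ∈ Icc (0 : ℝ) 1, Tendsto (fun i => t i j) U (𝓝 x) := fun j =>
    isCompact_Icc.ultrafilter_le_nhds (U.map fun i => t i j) (le_principal_iff.2 (htIcc j))
  choose x hx hlim using hlim
  have hzero : ∀ j, f (x j) = 0 := fun j =>
    tendsto_nhds_unique ((hF _ (hx j)).comp (Tendsto.prodMk (tendsto_id.mono_left hUl)
      (tendsto_nhdsWithin_iff.2 ⟨hlim j, htIcc j⟩)))
      (tendsto_const_nhds.congr' (ht.mono fun i h => (h.2 j).2.symm))
  -- Two zeros that merge enclose a zero of `F'` by Rolle, so their common limit is a double zero of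
  -- `f`.
  have hlt : ∀ j k, x j = x k → (∀ᶠ i in (U : Filter ι), t i j < t i k) → False := by
    intro j k hxe hev
    have hroll : ∀ᶠ i in (U : Filter ι), ∃ s, t i j ≤ s ∧ s ≤ t i k ∧ F' i s = 0 := by
      filter_upwards [hev, ht] with i hi hti
      have hsub : Icc (t i j) (t i k) ⊆ Icc 0 1 := Icc_subset_Icc (hti.2 j).1.1 (hti.2 k).1.2
      obtain ⟨s, hs, hs0⟩ := exists_hasDerivAt_eq_zero hi
        (fun y hy => (hFd i y (hsub hy)).continuousAt.continuousWithinAt)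
        ((hti.2 j).2.trans (hti.2 k).2.symm)
        (fun y hy => hFd i y (hsub (Ioo_subset_Icc_self hy)))
      exact ⟨s, hs.1.le, hs.2.le, hs0⟩
    obtain ⟨s, hs⟩ := hroll.choice
    have hslim : Tendsto s U (𝓝 (x j)) :=
      tendsto_of_tendsto_of_tendsto_of_le_of_le' (hlim j) (hxe ▸ hlim k)
        (hs.mono fun i h => h.1) (hs.mono fun i h => h.2.1)
    have hsIcc : ∀ᶠ i in (U : Filter ι), s i ∈ Icc (0 : ℝ) 1 := by
      filter_upwards [hs, htIcc j, htIcc k] with i h1 h2 h3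
      exact ⟨h2.1.trans h1.1, h1.2.1.trans h3.2⟩
    refine hf _ (hx j) (hzero j) (tendsto_nhds_unique
      ((hF' _ (hx j)).comp (Tendsto.prodMk (tendsto_id.mono_left hUl)
      (tendsto_nhdsWithin_iff.2 ⟨hslim, hsIcc⟩)))
      (tendsto_const_nhds.congr' (hs.mono fun i h => h.2.2.symm)))
  have hinj : Function.Injective x := by
    intro j k hxe
    by_contra hjk
    have hor : ∀ᶠ i in (U : Filter ι), t i j < t i k ∨ t i k < t i j :=
      ht.mono fun i h => lt_or_gt_of_ne (h.1.ne hjk)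
    rcases Ultrafilter.eventually_or.1 hor with h | h
    · exact hlt j k hxe h
    · exact hlt k j hxe.symm h
  have := hM (Finset.univ.map ⟨x, hinj⟩) (by
    intro y hy
    obtain ⟨j, -, rfl⟩ := Finset.mem_map.1 hy
    exact ⟨hx j, hzero j⟩)
  simp at this

/-- Simple zeros in `]0,1[` persist under pointwise convergence of continuous functions. -/
lemma eventually_exists_zeros
    (hF : ∀ x ∈ Icc (0 : ℝ) 1, Tendsto (fun i => F i x) l (𝓝 (f x)))
    (hFc : ∀ i, ContinuousOn (F i) (Icc 0 1))
    {T : Finset ℝ} (hT : ∀ x ∈ T, x ∈ Ioo (0 : ℝ) 1 ∧ f x = 0)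
    (hfd : ∀ x ∈ T, HasDerivAt f (f' x) x) (hf : ∀ x ∈ T, f' x ≠ 0) :
    ∀ᶠ i in l, ∃ T' : Finset ℝ, (∀ x ∈ T', x ∈ Ioo (0 : ℝ) 1 ∧ F i x = 0) ∧ T'.card = T.card := by
  -- Disjoint neighbourhoods keep the perturbed zeros distinct.
  obtain ⟨V, hV, hdisj⟩ := T.finite_toSet.t2_separation
  have key : ∀ x ∈ T, ∀ᶠ i in l, ∃ z ∈ V x ∩ Ioo 0 1, F i z = 0 := by
    intro x hxT
    have hnhds : V x ∩ Ioo 0 1 ∈ 𝓝 x :=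
      inter_mem ((hV x).2.mem_nhds (hV x).1) (isOpen_Ioo.mem_nhds (hT x hxT).1)
    obtain ⟨ε, hε, hball⟩ := Metric.mem_nhds_iff.1 hnhds
    have hsub : ∀ a b, x - ε < a → b < x + ε → Icc a b ⊆ V x ∩ Ioo 0 1 := fun a b ha hb y hy =>
      hball (by rw [Real.ball_eq_Ioo]; exact ⟨ha.trans_le hy.1, hy.2.trans_lt hb⟩)
    have hright : ∀ᶠ b in 𝓝[>] x, b < x + ε :=
      nhdsWithin_le_nhds (gt_mem_nhds (by linarith))
    have hleft : ∀ᶠ a in 𝓝[<] x, x - ε < a :=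
      nhdsWithin_le_nhds (lt_mem_nhds (by linarith))
    have hslope := hasDerivAt_iff_tendsto_slope.1 (hfd x hxT)
    have hsr := hslope.mono_left (nhdsWithin_mono x (fun y (hy : x < y) => ne_of_gt hy))
    have hsl := hslope.mono_left (nhdsWithin_mono x (fun y (hy : y < x) => ne_of_lt hy))
    have hfx := (hT x hxT).2
    have hs : ∀ y, slope f x y = f y / (y - x) := fun y => by
      rw [slope_def_field, hfx, sub_zero]
    simp only [funext hs] at hsr hsl
    rcases lt_or_gt_of_ne (hf x hxT) with hneg | hpos
    · obtain ⟨b, hb, hb1, hb2⟩ := (hright.and ((hsr.eventually (gt_mem_nhds hneg)).and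
        self_mem_nhdsWithin)).exists
      obtain ⟨a, ha, ha1, ha2⟩ := (hleft.and ((hsl.eventually (gt_mem_nhds hneg)).and
        self_mem_nhdsWithin)).exists
      have hb2' : x < b := hb2
      have ha2' : a < x := ha2
      have hfb : f b < 0 := by
        by_contra h
        exact absurd (div_nonneg (not_lt.1 h) (sub_pos.2 hb2').le) (not_le.2 hb1)
      have hfa : 0 < f a := by
        by_contra h
        exact absurd (div_nonneg_of_nonpos (not_lt.1 h) (sub_neg.2 ha2').le) (not_le.2 ha1)
      have hI := hsub a b ha hb
      have hI' : Icc a b ⊆ Icc 0 1 := fun y hy => Ioo_subset_Icc_self (hI hy).2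
      have hab : a ≤ b := (ha2'.trans hb2').le
      filter_upwards [(hF a (hI' (left_mem_Icc.2 hab))).eventually (lt_mem_nhds hfa),
        (hF b (hI' (right_mem_Icc.2 hab))).eventually (gt_mem_nhds hfb)] with i hia hib
      obtain ⟨z, hz, hz0⟩ := intermediate_value_Icc' hab ((hFc i).mono hI') ⟨hib.le, hia.le⟩
      exact ⟨z, hI hz, hz0⟩
    · obtain ⟨b, hb, hb1, hb2⟩ := (hright.and ((hsr.eventually (lt_mem_nhds hpos)).and
        self_mem_nhdsWithin)).exists
      obtain ⟨a, ha, ha1, ha2⟩ := (hleft.and ((hsl.eventually (lt_mem_nhds hpos)).and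
        self_mem_nhdsWithin)).exists
      have hb2' : x < b := hb2
      have ha2' : a < x := ha2
      have hfb : 0 < f b := by
        by_contra h
        exact absurd (div_nonpos_of_nonpos_of_nonneg (not_lt.1 h) (sub_pos.2 hb2').le) (not_le.2 hb1)
      have hfa : f a < 0 := by
        by_contra h
        exact absurd (div_nonpos_of_nonneg_of_nonpos (not_lt.1 h) (sub_neg.2 ha2').le)
          (not_le.2 ha1)
      have hI := hsub a b ha hb
      have hI' : Icc a b ⊆ Icc 0 1 := fun y hy => Ioo_subset_Icc_self (hI hy).2
      have hab : a ≤ b := (ha2'.trans hb2').le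
      filter_upwards [(hF a (hI' (left_mem_Icc.2 hab))).eventually (gt_mem_nhds hfa),
        (hF b (hI' (right_mem_Icc.2 hab))).eventually (lt_mem_nhds hfb)] with i hia hib
      obtain ⟨z, hz, hz0⟩ := intermediate_value_Icc hab ((hFc i).mono hI') ⟨hia.le, hib.le⟩
      exact ⟨z, hI hz, hz0⟩
  filter_upwards [(Filter.eventually_all_finset T).2 key] with i hi
  choose! z hz hz0 using hi
  refine ⟨T.image z, fun y hy => ?_, Finset.card_image_of_injOn fun x hx y hy hxy => ?_⟩
  · obtain ⟨x, hx, rfl⟩ := Finset.mem_image.1 hy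
    exact ⟨(hz x hx).2, hz0 x hx⟩
  · by_contra hne
    exact (disjoint_left.1 (hdisj hx hy hne)) (hz x hx).1 (by rw [hxy]; exact (hz y hy).1)

end Perturbation

/-! ### Oscillation: counting zeros of the shooting solutions -/

lemma finite_zeros {f f' : ℝ → ℝ} (hd : ∀ x ∈ Icc (0 : ℝ) 1, HasDerivAt f (f' x) x)
    (hf : ∀ x ∈ Icc (0 : ℝ) 1, f x = 0 → f' x ≠ 0) :
    {x | x ∈ Icc (0 : ℝ) 1 ∧ f x = 0}.Finite := by
  by_contra hinf
  obtain ⟨x, hx, hacc⟩ := Set.Infinite.exists_accPt_of_subset_isCompact hinf isCompact_Icc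
    fun x hx => hx.1
  rw [accPt_iff_frequently_nhdsNE] at hacc
  refine hacc ?_
  have : ∀ᶠ y in 𝓝[≠] x, f y ≠ 0 := by
    by_cases h0 : f x = 0
    · exact (hd x hx).eventually_ne (hf x hx h0)
    · exact nhdsWithin_le_nhds ((hd x hx).continuousAt.eventually_ne h0)
  filter_upwards [this] with y hy hmem using hy hmem.2

namespace IsSolutionPair

variable {q : ℝ → ℝ} {lam : ℝ} {y z : ℝ → ℝ}

lemma snd_ne_zero_of_fst_eq_zero (h : IsSolutionPair q lam y z) (hq : ContinuousOn q (Icc 0 1))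
    (hz : z 0 ≠ 0) : ∀ x ∈ Icc (0 : ℝ) 1, y x = 0 → z x ≠ 0 := fun _ hx hyx hzx =>
  hz (h.eq_zero_of_double_zero hq hx hyx hzx 0 (left_mem_Icc.2 zero_le_one)).2

lemma finite_zeros (h : IsSolutionPair q lam y z) (hq : ContinuousOn q (Icc 0 1))
    (hz : z 0 ≠ 0) : {x | x ∈ Ioo (0 : ℝ) 1 ∧ y x = 0}.Finite :=
  (SturmLiouville.finite_zeros h.hasDerivAt_fst (h.snd_ne_zero_of_fst_eq_zero hq hz)).subset
    fun _ hx => ⟨Ioo_subset_Icc_self hx.1, hx.2⟩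

/-- Below the minimum of the potential, the shooting solution has no zeros. -/
lemma ne_zero_of_le_potential (h : IsSolutionPair q lam y z) (hy : y 0 = 0) (hz : z 0 ≠ 0)
    (hle : ∀ x ∈ Icc (0 : ℝ) 1, lam ≤ q x) : ∀ x ∈ Ioo (0 : ℝ) 1, y x ≠ 0 := by
  intro x hx hyx
  -- The product `y y'` is nondecreasing and vanishes at 0 and at `x`, hence in between; but its
  -- derivative at 0 is `z 0 ^ 2 ≠ 0`.
  have hp : ∀ t ∈ Icc (0 : ℝ) 1,
      HasDerivAt (fun t => y t * z t) (z t * z t + (q t - lam) * (y t * y t)) t := fun t ht =>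
    ((h.hasDerivAt_fst t ht).mul (h.hasDerivAt_snd t ht)).congr_deriv (by ring)
  have hmono : MonotoneOn (fun t => y t * z t) (Icc 0 1) := by
    refine monotoneOn_of_hasDerivWithinAt_nonneg (convex_Icc 0 1)
      (fun t ht => (hp t ht).continuousAt.continuousWithinAt)
      (fun t ht => (hp t (interior_subset ht)).hasDerivWithinAt) fun t ht => ?_
    have := hle t (interior_subset ht)
    exact add_nonneg (mul_self_nonneg _) (mul_nonneg (by linarith) (mul_self_nonneg _))
  have h0 : (0 : ℝ) ∈ Icc (0 : ℝ) 1 := left_mem_Icc.2 zero_le_one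
  have hne : ∀ᶠ t in 𝓝[≠] (0 : ℝ), y t * z t ≠ 0 :=
    (hp 0 h0).eventually_ne (by simpa [hy] using hz)
  have hne' : ∀ᶠ t in 𝓝[>] (0 : ℝ), y t * z t ≠ 0 :=
    hne.filter_mono (nhdsWithin_mono _ fun t (ht : 0 < t) => ne_of_gt ht)
  obtain ⟨t, ht, ht'⟩ := (hne'.and (Ioo_mem_nhdsGT hx.1)).exists
  have htI : t ∈ Icc (0 : ℝ) 1 := ⟨ht'.1.le, ht'.2.le.trans hx.2.le⟩
  have h1 := hmono h0 htI ht'.1.le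
  have h2 := hmono htI (Ioo_subset_Icc_self hx) ht'.2.le
  simp only [hy, hyx, zero_mul] at h1 h2
  exact ht (le_antisymm h2 h1)

lemma isDirichletEigenvalue (h : IsSolutionPair q lam y z) (hq : ContinuousOn q (Icc 0 1))
    (hy : y 0 = 0) (hz : z 0 ≠ 0) (hy1 : y 1 = 0) : IsDirichletEigenvalue q lam := by
  have hderiv : ∀ x ∈ Ioo (0 : ℝ) 1, deriv y =ᶠ[𝓝 x] z := fun x hx => by
    filter_upwards [isOpen_Ioo.mem_nhds hx] with t ht
    exact (h.hasDerivAt_fst t (Ioo_subset_Icc_self ht)).deriv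
  refine ⟨y, h.continuousOn_fst, fun x hx =>
    (h.hasDerivAt_fst x (Ioo_subset_Icc_self hx)).differentiableAt, fun x hx =>
    ((hderiv x hx).differentiableAt_iff).2
      (h.hasDerivAt_snd x (Ioo_subset_Icc_self hx)).differentiableAt, fun x hx => ?_, hy, hy1, ?_⟩
  · rw [(hderiv x hx).deriv_eq, (h.hasDerivAt_snd x (Ioo_subset_Icc_self hx)).deriv]
    ring
  · by_contra! hcon
    refine (Ioo_infinite (zero_lt_one' ℝ)) ((h.finite_zeros hq hz).subset fun x hx => ⟨hx, hcon x hx⟩)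

end IsSolutionPair

/-- If the shooting solution for `Λ` has more than `j` zeros in `]0,1[`, then there is a Dirichlet
eigenvalue below `Λ` whose shooting solution has exactly `j` zeros. -/
lemma exists_eigenvalue_lt_of_lt_ncard {q : ℝ → ℝ} (hq : ContinuousOn q (Icc 0 1))
    {φ ψ : ℝ → ℝ → ℝ}
    (hsol : ∀ lam, IsSolutionPair q lam (φ lam) (ψ lam) ∧ φ lam 0 = 0 ∧ ψ lam 0 = 1)
    (hφ : ∀ lam, ∀ x ∈ Icc (0 : ℝ) 1,
        Tendsto (fun p : ℝ × ℝ => φ p.1 p.2) (𝓝 lam ×ˢ 𝓝[Icc 0 1] x) (𝓝 (φ lam x)))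
    (hψ : ∀ lam, ∀ x ∈ Icc (0 : ℝ) 1,
        Tendsto (fun p : ℝ × ℝ => ψ p.1 p.2) (𝓝 lam ×ˢ 𝓝[Icc 0 1] x) (𝓝 (ψ lam x)))
    {Λ : ℝ} {j : ℕ} (hj : j < {x | x ∈ Ioo (0 : ℝ) 1 ∧ φ Λ x = 0}.ncard) :
    ∃ μ < Λ, φ μ 1 = 0 ∧ {x | x ∈ Ioo (0 : ℝ) 1 ∧ φ μ x = 0}.ncard = j := by
  set N : ℝ → ℕ := fun lam => {x | x ∈ Ioo (0 : ℝ) 1 ∧ φ lam x = 0}.ncard with hN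
  have hψ0 : ∀ lam, ψ lam 0 ≠ 0 := fun lam => by rw [(hsol lam).2.2]; exact one_ne_zero
  have hfin : ∀ lam, {x | x ∈ Ioo (0 : ℝ) 1 ∧ φ lam x = 0}.Finite := fun lam =>
    (hsol lam).1.finite_zeros hq (hψ0 lam)
  have hfin' : ∀ lam, {x | x ∈ Icc (0 : ℝ) 1 ∧ φ lam x = 0}.Finite := fun lam =>
    finite_zeros (hsol lam).1.hasDerivAt_fst ((hsol lam).1.snd_ne_zero_of_fst_eq_zero hq (hψ0 lam))
  have hsimple := fun lam => (hsol lam).1.snd_ne_zero_of_fst_eq_zero hq (hψ0 lam)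
  have hlower : ∀ μ, ∀ᶠ lam in 𝓝 μ, N μ ≤ N lam := by
    intro μ
    have hT : ∀ x ∈ (hfin μ).toFinset, x ∈ Ioo (0 : ℝ) 1 ∧ φ μ x = 0 := fun x hx => by
      simpa using hx
    have hpt : ∀ x ∈ Icc (0 : ℝ) 1, Tendsto (fun lam => φ lam x) (𝓝 μ) (𝓝 (φ μ x)) := fun x hx =>
      (hφ μ x hx).comp (tendsto_id.prodMk
        (tendsto_nhdsWithin_iff.2 ⟨tendsto_const_nhds, Eventually.of_forall fun _ => hx⟩))
    filter_upwards [eventually_exists_zeros hpt (fun lam => (hsol lam).1.continuousOn_fst) hT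
      (fun x hx => (hsol μ).1.hasDerivAt_fst x (Ioo_subset_Icc_self (hT x hx).1))
      (fun x hx => hsimple μ x (Ioo_subset_Icc_self (hT x hx).1) (hT x hx).2)] with lam hlam
    obtain ⟨T', hT', hcard⟩ := hlam
    rw [← ncard_eq_toFinset_card _ (hfin μ)] at hcard
    rw [hN]
    dsimp only
    rw [← hcard, ← ncard_coe_finset]
    exact ncard_le_ncard (fun x hx => hT' x hx) (hfin lam)
  -- The `+ 1` is the permanent zero at 0. Thus `N` can exceed its value at `μ` nearby only if `φ μ`
  -- vanishes at 1.
  have hupper : ∀ μ, ∀ᶠ lam in 𝓝 μ, N lam + 1 ≤ {x | x ∈ Icc (0 : ℝ) 1 ∧ φ μ x = 0}.ncard := by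
    intro μ
    filter_upwards [eventually_card_zeros_le (hφ μ) (hψ μ)
      (fun lam => (hsol lam).1.hasDerivAt_fst) (hsimple μ)
      (M := {x | x ∈ Icc (0 : ℝ) 1 ∧ φ μ x = 0}.ncard) (fun T hT => by
        rw [← ncard_coe_finset]
        exact ncard_le_ncard (fun x hx => hT x hx) (hfin' μ))] with lam hlam
    have h := hlam (insert 0 (hfin lam).toFinset) (by
      intro x hx
      rcases Finset.mem_insert.1 hx with rfl | hx
      · exact ⟨left_mem_Icc.2 zero_le_one, (hsol lam).2.1⟩
      · have hx' : x ∈ Ioo (0 : ℝ) 1 ∧ φ lam x = 0 := by simpa using hx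
        exact ⟨Ioo_subset_Icc_self hx'.1, hx'.2⟩)
    rwa [Finset.card_insert_of_notMem (by simp), ← ncard_eq_toFinset_card _ (hfin lam)] at h
  have hIcc : ∀ μ, φ μ 1 ≠ 0 → {x | x ∈ Icc (0 : ℝ) 1 ∧ φ μ x = 0}.ncard ≤ N μ + 1 := by
    intro μ h1
    refine (ncard_le_ncard (t := insert 0 {x | x ∈ Ioo (0 : ℝ) 1 ∧ φ μ x = 0}) (fun x hx => ?_)
      ((hfin μ).insert 0)).trans (ncard_insert_le _ _)
    rcases hx.1.1.eq_or_lt with h | h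
    · exact Or.inl h.symm
    · refine Or.inr ⟨⟨h, lt_of_le_of_ne hx.1.2 ?_⟩, hx.2⟩
      rintro rfl
      exact h1 hx.2
  have hIcc' : ∀ μ, {x | x ∈ Icc (0 : ℝ) 1 ∧ φ μ x = 0}.ncard ≤ N μ + 2 := by
    intro μ
    refine (ncard_le_ncard (t := insert 1 (insert 0 {x | x ∈ Ioo (0 : ℝ) 1 ∧ φ μ x = 0}))
      (fun x hx => ?_) (((hfin μ).insert 0).insert 1)).trans ((ncard_insert_le _ _).trans
        (Nat.succ_le_succ (ncard_insert_le _ _)))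
    rcases hx.1.1.eq_or_lt with h | h
    · exact Or.inr (Or.inl h.symm)
    · rcases hx.1.2.eq_or_lt with h' | h'
      · exact Or.inl h'
      · exact Or.inr (Or.inr ⟨⟨h, h'⟩, hx.2⟩)
  obtain ⟨K, hK⟩ := isCompact_Icc.exists_bound_of_continuousOn hq
  set A : Set ℝ := {lam | lam ≤ Λ ∧ N lam ≤ j} with hA
  have hAne : A.Nonempty := by
    refine ⟨min Λ (-K), min_le_left _ _, ?_⟩
    have hempty : {x | x ∈ Ioo (0 : ℝ) 1 ∧ φ (min Λ (-K)) x = 0} = ∅ := by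
      refine eq_empty_of_forall_notMem fun x hx => ?_
      refine (hsol _).1.ne_zero_of_le_potential (hsol _).2.1 (hψ0 _) (fun t ht => ?_) x hx.1 hx.2
      exact (min_le_right _ _).trans (abs_le.1 (hK t ht)).1
    rw [hN]
    dsimp only
    rw [hempty, ncard_empty]
    exact Nat.zero_le j
  have hAbdd : BddAbove A := ⟨Λ, fun lam h => h.1⟩
  -- The last parameter with at most `j` zeros: `N μ ≤ j` by lower semicontinuity, while `N > j`
  -- just above `μ`. So `φ μ` has at least `j + 2` zeros in `[0,1]`, which forces both a zero at 1
  -- and `N μ = j`.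
  set μ := sSup A with hμ
  have hfreq : ∃ᶠ lam in 𝓝 μ, lam ∈ A := mem_closure_iff_frequently.1 (csSup_mem_closure hAne hAbdd)
  have hNμ : N μ ≤ j := by
    obtain ⟨lam, h1, h2⟩ := (hfreq.and_eventually (hlower μ)).exists
    exact h2.trans h1.2
  have hμΛ : μ < Λ := by
    refine lt_of_le_of_ne (csSup_le hAne fun lam h => h.1) fun h => ?_
    rw [h] at hNμ
    exact absurd hj (not_lt.2 hNμ)
  obtain ⟨lam, hlam, hIoo⟩ := (((hupper μ).filter_mono nhdsWithin_le_nhds).and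
    (Ioo_mem_nhdsGT hμΛ)).exists
  have hjlam : j < N lam := by
    by_contra h
    exact absurd (le_csSup hAbdd ⟨hIoo.2.le, not_lt.1 h⟩) (not_le.2 hIoo.1)
  have hone : φ μ 1 = 0 := by
    by_contra h
    have := hIcc μ h
    omega
  have := hIcc' μ
  refine ⟨μ, hμΛ, hone, ?_⟩
  change N μ = j
  omega

/-- The eigenfunction of the `J`-th lowest eigenvalue (counted from `0`) has at most `J` zeros in
`]0,1[`. -/
theorem AreFirstEigenvalues.card_zeros_le {q : ℝ → ℝ} (hq : ContinuousOn q (Icc 0 1)) {n : ℕ}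
    {lam : Fin n → ℝ} (hlam : AreFirstEigenvalues q lam) {J : Fin n} {y z : ℝ → ℝ}
    (h : IsSolutionPair q (lam J) y z) (hy : y 0 = 0) (hz : z 0 ≠ 0) {T : Finset ℝ}
    (hT : ∀ x ∈ T, x ∈ Ioo (0 : ℝ) 1 ∧ y x = 0) : T.card ≤ J := by
  obtain ⟨φ, ψ, hsol, hφ, hψ⟩ := exists_shooting_solution hq
  have hprop : ∀ x ∈ Icc (0 : ℝ) 1, y x = z 0 * φ (lam J) x := fun x hx => by
    have := ((h.sub_smul (hsol (lam J)).1 (z 0)).eq_zero_of_double_zero hq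
      (left_mem_Icc.2 zero_le_one) (by simp [hy, (hsol (lam J)).2.1])
      (by simp [(hsol (lam J)).2.2]) x hx).1
    linarith
  have hψ0 : ∀ lam, ψ lam 0 ≠ 0 := fun lam => by rw [(hsol lam).2.2]; exact one_ne_zero
  have hle : T.card ≤ {x | x ∈ Ioo (0 : ℝ) 1 ∧ φ (lam J) x = 0}.ncard := by
    rw [← ncard_coe_finset]
    refine ncard_le_ncard (fun x hx => ⟨(hT x hx).1, ?_⟩) ((hsol _).1.finite_zeros hq (hψ0 _))
    have := (hT x hx).2
    rw [hprop x (Ioo_subset_Icc_self (hT x hx).1)] at this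
    exact (mul_eq_zero.1 this).resolve_left hz
  by_contra! hcon
  -- With more than `J` zeros there would be, for each `i ≤ J`, an eigenvalue below `lam J` with
  -- exactly `i` zeros: `J + 1` distinct ones, where only `J` are available.
  have hex : ∀ i : Fin (J + 1), ∃ s : Fin n, s < J ∧
      {x | x ∈ Ioo (0 : ℝ) 1 ∧ φ (lam s) x = 0}.ncard = i := fun i => by
    obtain ⟨μ, hμ, hμ1, hcard⟩ := exists_eigenvalue_lt_of_lt_ncard hq hsol hφ hψ (Λ := lam J)
      (j := i) (by have := i.2; omega)
    rcases hlam.lowest μ ((hsol μ).1.isDirichletEigenvalue hq (hsol μ).2.1 (hψ0 μ) hμ1) with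
      ⟨s, rfl⟩ | h
    · exact ⟨s, hlam.strictMono.lt_iff_lt.1 hμ, hcard⟩
    · exact absurd (h J) (not_lt.2 hμ.le)
  choose s hs hcard using hex
  have hinj : Function.Injective s := fun i k hik => by
    apply Fin.ext
    rw [← hcard i, ← hcard k, hik]
  have := Finset.card_le_card_of_injOn (s := Finset.univ) (t := Finset.Iio J) s
    (fun i _ => by simpa using hs i) hinj.injOn
  simp at this

/-! ### Zeros with multiplicity and Rolle's theorem -/

/-- `f` has at least `N` zeros in `]0,1[`, counted with multiplicities. -/
def HasZeros (f : ℝ → ℝ) (N : ℕ) : Prop :=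
  ∃ (T : Finset ℝ) (k : ℝ → ℕ),
    (∀ c ∈ T, c ∈ Ioo (0 : ℝ) 1 ∧ ∀ m < k c, iteratedDeriv m f c = 0) ∧ N ≤ ∑ c ∈ T, k c

lemma hasZeros_zero (f : ℝ → ℝ) : HasZeros f 0 := ⟨∅, 0, by simp, by simp⟩

lemma HasZeros.exists_pos {f : ℝ → ℝ} {N : ℕ} (h : HasZeros f N) :
    ∃ (T : Finset ℝ) (k : ℝ → ℕ), (∀ c ∈ T, c ∈ Ioo (0 : ℝ) 1 ∧ 1 ≤ k c ∧
      ∀ m < k c, iteratedDeriv m f c = 0) ∧ N ≤ ∑ c ∈ T, k c := by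
  obtain ⟨T, k, hT, hN⟩ := h
  refine ⟨T.filter fun c => k c ≠ 0, k, fun c hc => ?_, ?_⟩
  · rw [Finset.mem_filter] at hc
    exact ⟨(hT c hc.1).1, Nat.one_le_iff_ne_zero.2 hc.2, (hT c hc.1).2⟩
  · rwa [Finset.sum_filter_ne_zero]

lemma HasZeros.congr {f g : ℝ → ℝ} {N : ℕ} (h : HasZeros f N) (hfg : EqOn f g (Ioo 0 1)) :
    HasZeros g N := by
  obtain ⟨T, k, hT, hN⟩ := h
  refine ⟨T, k, fun c hc => ⟨(hT c hc).1, fun m hm => ?_⟩, hN⟩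
  rw [← (hfg.eventuallyEq_of_mem (isOpen_Ioo.mem_nhds (hT c hc).1)).iteratedDeriv_eq m]
  exact (hT c hc).2 m hm

lemma HasZeros.mul_left {f g : ℝ → ℝ} {N : ℕ} (h : HasZeros f N) (hg : ContDiffOn ℝ ∞ g (Ioo 0 1))
    (hf : ContDiffOn ℝ ∞ f (Ioo 0 1)) : HasZeros (fun x => g x * f x) N := by
  obtain ⟨T, k, hT, hN⟩ := h
  refine ⟨T, k, fun c hc => ⟨(hT c hc).1, fun m hm => ?_⟩, hN⟩
  have hnhds := isOpen_Ioo.mem_nhds (hT c hc).1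
  have hle : ((m : ℕ∞) : WithTop ℕ∞) ≤ ∞ := by exact_mod_cast le_top
  rw [iteratedDeriv_fun_mul ((hg.contDiffAt hnhds).of_le hle) ((hf.contDiffAt hnhds).of_le hle)]
  refine Finset.sum_eq_zero fun i _ => ?_
  rw [(hT c hc).2 (m - i) (lt_of_le_of_lt (Nat.sub_le m i) hm), mul_zero]

/-- Rolle's theorem for a finite set of zeros. -/
lemma exists_zeros_deriv {f : ℝ → ℝ} {T : Finset ℝ} (hT : ∀ x ∈ T, x ∈ Icc (0 : ℝ) 1)
    (hc : ∀ x ∈ T, ∀ y ∈ T, ContinuousOn f (Icc x y)) (h0 : ∀ x ∈ T, f x = 0) :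
    ∃ R : Finset ℝ, (∀ x ∈ R, x ∈ Ioo (0 : ℝ) 1 ∧ x ∉ T ∧ deriv f x = 0) ∧ T.card ≤ R.card + 1 := by
  by_cases hD : {x | x ∈ Ioo (0 : ℝ) 1 ∧ deriv f x = 0}.Finite
  · refine ⟨hD.toFinset \ T, fun x hx => ?_, Finset.card_le_sdiff_of_interleaved
      fun x hx y hy hxy _ => ?_⟩
    · rw [Finset.mem_sdiff, Finite.mem_toFinset] at hx
      exact ⟨hx.1.1, hx.2, hx.1.2⟩
    · obtain ⟨z, hz, hz0⟩ := exists_deriv_eq_zero hxy (hc x hx y hy) ((h0 x hx).trans (h0 y hy).symm)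
      refine ⟨z, ?_, hz.1, hz.2⟩
      rw [Finite.mem_toFinset]
      exact ⟨⟨(hT x hx).1.trans_lt hz.1, hz.2.trans_le (hT y hy).2⟩, hz0⟩
  -- If `deriv f` has infinitely many zeros, any `T.card` of them off `T` will do.
  · have hD' : ({x | x ∈ Ioo (0 : ℝ) 1 ∧ deriv f x = 0} \ (T : Set ℝ)).Infinite :=
      Set.Infinite.sdiff hD T.finite_toSet
    obtain ⟨R, hR, hcard⟩ := hD'.exists_subset_card_eq T.card
    exact ⟨R, fun x hx => ⟨(hR hx).1.1, (hR hx).2, (hR hx).1.2⟩, by omega⟩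

/-- Rolle's theorem for zeros counted with multiplicities; `E` is a set of additional zeros. -/
lemma hasZeros_deriv {f : ℝ → ℝ} {T E : Finset ℝ} {k : ℝ → ℕ} {N : ℕ}
    (hT : ∀ c ∈ T, c ∈ Ioo (0 : ℝ) 1 ∧ 1 ≤ k c ∧ ∀ m < k c, iteratedDeriv m f c = 0)
    (hE : ∀ c ∈ E, c ∈ Icc (0 : ℝ) 1 ∧ f c = 0) (hTE : Disjoint T E)
    (hc : ∀ x ∈ T ∪ E, ∀ y ∈ T ∪ E, ContinuousOn f (Icc x y))
    (hN : N + 1 ≤ ∑ c ∈ T, k c + E.card) : HasZeros (deriv f) N := by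
  obtain ⟨R, hR, hcard⟩ := exists_zeros_deriv (T := T ∪ E) (fun x hx => by
      rcases Finset.mem_union.1 hx with h | h
      · exact Ioo_subset_Icc_self (hT x h).1
      · exact (hE x h).1) hc (fun x hx => by
      rcases Finset.mem_union.1 hx with h | h
      · simpa using (hT x h).2.2 0 (hT x h).2.1
      · exact (hE x h).2)
  have hTR : Disjoint T R := Finset.disjoint_right.2 fun x hx hxT =>
    (hR x hx).2.1 (Finset.mem_union_left _ hxT)
  -- Old zeros lose one order and Rolle's new ones count once, for a total of at least `(∑ k - |T|)
  -- + (|T| + |E| - 1)`.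
  refine ⟨T ∪ R, fun c => if c ∈ T then k c - 1 else 1, fun c hc => ?_, ?_⟩
  · by_cases hcT : c ∈ T
    · refine ⟨(hT c hcT).1, fun m hm => ?_⟩
      dsimp only at hm
      rw [if_pos hcT] at hm
      rw [← iteratedDeriv_succ']
      exact (hT c hcT).2.2 _ (by omega)
    · have hcR := hR c ((Finset.mem_union.1 hc).resolve_left hcT)
      refine ⟨hcR.1, fun m hm => ?_⟩
      dsimp only at hm
      rw [if_neg hcT, Nat.lt_one_iff] at hm
      rw [hm, iteratedDeriv_zero]
      exact hcR.2.2
  · rw [Finset.sum_union hTR]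
    have h1 : ∑ c ∈ T, (if c ∈ T then k c - 1 else 1) + T.card = ∑ c ∈ T, k c := by
      rw [Finset.card_eq_sum_ones, ← Finset.sum_add_distrib]
      refine Finset.sum_congr rfl fun c hc => ?_
      rw [if_pos hc]
      exact Nat.sub_add_cancel (hT c hc).2.1
    have h2 : ∑ c ∈ R, (if c ∈ T then k c - 1 else 1) = R.card := by
      rw [Finset.card_eq_sum_ones]
      exact Finset.sum_congr rfl fun c hc => if_neg (Finset.disjoint_right.1 hTR hc)
    rw [Finset.card_union_of_disjoint hTE] at hcard
    omega

lemma HasZeros.deriv_of_continuousOn_Ioo {f : ℝ → ℝ} {N : ℕ} (h : HasZeros f (N + 1))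
    (hf : ContinuousOn f (Ioo 0 1)) : HasZeros (deriv f) N := by
  obtain ⟨T, k, hT, hN⟩ := h.exists_pos
  refine hasZeros_deriv (E := ∅) hT (by simp) (by simp) (fun x hx y hy => ?_) (by simpa using hN)
  rw [Finset.union_empty] at hx hy
  exact hf.mono (Icc_subset_Ioo (hT x hx).1.1 (hT y hy).1.2)

lemma HasZeros.deriv_of_boundary {f : ℝ → ℝ} {N : ℕ} (h : HasZeros f N)
    (hf : ContinuousOn f (Icc 0 1)) (h0 : f 0 = 0) (h1 : f 1 = 0) : HasZeros (deriv f) (N + 1) := by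
  obtain ⟨T, k, hT, hN⟩ := h.exists_pos
  have hE : ∀ c ∈ ({0, 1} : Finset ℝ), c ∈ Icc (0 : ℝ) 1 ∧ f c = 0 := by simp [h0, h1]
  refine hasZeros_deriv (E := {0, 1}) hT hE ?_ (fun x hx y hy => hf.mono ?_) ?_
  · rw [Finset.disjoint_right]
    intro x hx hxT
    have := (hT x hxT).1
    rcases Finset.mem_insert.1 hx with rfl | hx
    · exact lt_irrefl _ this.1
    · rw [Finset.mem_singleton.1 hx] at this
      exact lt_irrefl _ this.2
  · have hI : ∀ x ∈ T ∪ {0, 1}, x ∈ Icc (0 : ℝ) 1 := fun x hx => by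
      rcases Finset.mem_union.1 hx with h | h
      · exact Ioo_subset_Icc_self (hT x h).1
      · exact (hE x h).1
    exact Icc_subset_Icc (hI x hx).1 (hI y hy).2
  · rw [Finset.card_pair (zero_ne_one' ℝ)]
    omega

/-- If `u` has no zeros in `]0,1[` and the Wronskian `w = u S' - u' S` vanishes at both ends and
satisfies `w' = u r`, then `r` has at least as many zeros as `S`. -/
lemma HasZeros.of_wronskian {u u' S S' r w : ℝ → ℝ} {N : ℕ} (h : HasZeros S N)
    (hu : ContDiffOn ℝ ∞ u (Ioo 0 1)) (hS : ContDiffOn ℝ ∞ S (Ioo 0 1))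
    (hu0 : ∀ x ∈ Ioo (0 : ℝ) 1, u x ≠ 0)
    (hud : ∀ x ∈ Ioo (0 : ℝ) 1, HasDerivAt u (u' x) x)
    (hSd : ∀ x ∈ Ioo (0 : ℝ) 1, HasDerivAt S (S' x) x)
    (hw : ∀ x ∈ Ioo (0 : ℝ) 1, w x = u x * S' x - u' x * S x)
    (hwc : ContinuousOn w (Icc 0 1)) (hw0 : w 0 = 0) (hw1 : w 1 = 0)
    (hwd : ∀ x ∈ Ioo (0 : ℝ) 1, HasDerivAt w (u x * r x) x) : HasZeros r N := by
  -- For `N + 1` zeros the count runs `N + 1` for `S/u`, `N` for its derivative and for `w`, then `N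
  -- + 1` for `w' = u r`. The first Rolle step needs at least one zero.
  obtain _ | N := N
  · exact hasZeros_zero r
  have huinv : ContDiffOn ℝ ∞ (fun x => (u x)⁻¹) (Ioo 0 1) := hu.inv hu0
  have hf : ContDiffOn ℝ ∞ (fun x => (u x)⁻¹ * S x) (Ioo 0 1) := huinv.mul hS
  have hf' : ContDiffOn ℝ ∞ (deriv fun x => (u x)⁻¹ * S x) (Ioo 0 1) :=
    hf.deriv_of_isOpen isOpen_Ioo (by simp)
  have hu2 : ContDiffOn ℝ ∞ (fun x => u x ^ 2) (Ioo 0 1) := hu.pow 2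
  have hfw : EqOn (fun x => u x ^ 2 * deriv (fun x => (u x)⁻¹ * S x) x) w (Ioo 0 1) := by
    intro x hx
    have hd := ((hud x hx).inv (hu0 x hx)).mul (hSd x hx)
    have hd' : deriv (fun x => (u x)⁻¹ * S x) x = -u' x / u x ^ 2 * S x + (u x)⁻¹ * S' x := hd.deriv
    have := hu0 x hx
    simp only [hd', hw x hx]
    field_simp
    ring
  have h1 : HasZeros w N := (((h.mul_left huinv hS).deriv_of_continuousOn_Ioo
    hf.continuousOn).mul_left hu2 hf').congr hfw
  -- Smoothness of `w` is read off from `w = u² (S/u)'`, since `u'` and `S'` are not assumed smooth.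
  have hwsm : ContDiffOn ℝ ∞ w (Ioo 0 1) := (hu2.mul hf').congr fun x hx => (hfw hx).symm
  refine ((h1.deriv_of_boundary hwc hw0 hw1).mul_left huinv
    (hwsm.deriv_of_isOpen isOpen_Ioo (by simp))).congr fun x hx => ?_
  have := hu0 x hx
  simp only [(hwd x hx).deriv]
  field_simp

/-! ### Zeros of combinations of eigenfunctions -/

/-- Bootstrap: each equation of the system gives its unknown one more derivative than the right-hand
side has. -/
lemma IsSolutionPair.contDiffOn {q : ℝ → ℝ} {lam : ℝ} {y z : ℝ → ℝ}
    (h : IsSolutionPair q lam y z) (hq : ContDiffOn ℝ ∞ q (Ioo 0 1)) :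
    ContDiffOn ℝ ∞ y (Ioo 0 1) := by
  have hy : ∀ x ∈ Ioo (0 : ℝ) 1, HasDerivAt y (z x) x := fun x hx =>
    h.hasDerivAt_fst x (Ioo_subset_Icc_self hx)
  have hz : ∀ x ∈ Ioo (0 : ℝ) 1, HasDerivAt z ((q x - lam) * y x) x := fun x hx =>
    h.hasDerivAt_snd x (Ioo_subset_Icc_self hx)
  have key : ∀ n : ℕ, ContDiffOn ℝ n y (Ioo 0 1) ∧ ContDiffOn ℝ n z (Ioo 0 1) := by
    intro n
    induction n with
    | zero =>
      simp only [Nat.cast_zero, contDiffOn_zero]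
      exact ⟨fun x hx => (hy x hx).continuousAt.continuousWithinAt,
        fun x hx => (hz x hx).continuousAt.continuousWithinAt⟩
    | succ n ih =>
      have hqn : ContDiffOn ℝ n q (Ioo 0 1) := contDiffOn_infty.1 hq n
      push_cast
      rw [contDiffOn_succ_iff_deriv_of_isOpen isOpen_Ioo,
        contDiffOn_succ_iff_deriv_of_isOpen isOpen_Ioo]
      refine ⟨⟨fun x hx => (hy x hx).differentiableAt.differentiableWithinAt, by simp,
        ih.2.congr fun x hx => (hy x hx).deriv⟩,
        fun x hx => (hz x hx).differentiableAt.differentiableWithinAt, by simp,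
        ((hqn.sub contDiffOn_const).mul ih.1).congr fun x hx => (hz x hx).deriv⟩
  exact contDiffOn_infty.2 fun n => (key n).1

lemma linComb_smul {n : ℕ} (h : Fin n → ℝ → ℝ) (b : Fin n → ℝ) (a x : ℝ) :
    linComb h (fun j => a * b j) x = a * linComb h b x := by
  simp only [linComb, Finset.mul_sum, mul_assoc]

lemma contDiffOn_linComb {n : ℕ} {h : Fin n → ℝ → ℝ} {s : Set ℝ}
    (hh : ∀ i, ContDiffOn ℝ ∞ (h i) s) (b : Fin n → ℝ) : ContDiffOn ℝ ∞ (linComb h b) s :=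
  ContDiffOn.sum fun i _ => contDiffOn_const.mul (hh i)

lemma hasDerivAt_linComb {n : ℕ} {h : Fin n → ℝ → ℝ} {d : Fin n → ℝ} {x : ℝ}
    (hh : ∀ i, HasDerivAt (h i) (d i) x) (b : Fin n → ℝ) :
    HasDerivAt (linComb h b) (∑ j, b j * d j) x :=
  HasDerivAt.fun_sum fun i _ => (hh i).const_mul (b i)

lemma iteratedDeriv_linComb {n : ℕ} {h : Fin n → ℝ → ℝ} {x : ℝ} {m : ℕ}
    (hh : ∀ i, ContDiffAt ℝ m (h i) x) (b : Fin n → ℝ) :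
    iteratedDeriv m (linComb h b) x = ∑ j, b j * iteratedDeriv m (h j) x := by
  have : linComb h b = fun x => ∑ j, b j * h j x := rfl
  rw [this, iteratedDeriv_fun_sum fun i _ => contDiffAt_const.mul (hh i)]
  exact Finset.sum_congr rfl fun i _ => iteratedDeriv_const_mul_field (b i) (h i)

section EigenfunctionSums

variable {q : ℝ → ℝ} {n : ℕ} {lam : Fin n → ℝ} {H H' : Fin n → ℝ → ℝ}

/-- Multiplying the `j`-th coefficient by `lam i - lam j` does not decrease the number of zeros of a
linear combination, if the `i`-th eigenfunction has no zeros. -/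
lemma hasZeros_linComb_sub_mul (hq : ContDiffOn ℝ ∞ q (Ioo 0 1))
    (hH : ∀ i, IsSolutionPair q (lam i) (H i) (H' i)) (h0 : ∀ i, H i 0 = 0) (h1 : ∀ i, H i 1 = 0)
    {i : Fin n} (hi : ∀ x ∈ Ioo (0 : ℝ) 1, H i x ≠ 0) {b : Fin n → ℝ} {N : ℕ}
    (h : HasZeros (linComb H b) N) :
    HasZeros (linComb H fun j => (lam i - lam j) * b j) N := by
  have hd : ∀ x ∈ Icc (0 : ℝ) 1, HasDerivAt (linComb H b) (linComb H' b x) x := fun x hx =>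
    hasDerivAt_linComb (fun j => (hH j).hasDerivAt_fst x hx) b
  -- In `u S'' - u'' S` the potential cancels and only differences of eigenvalues remain.
  have hw : ∀ x ∈ Icc (0 : ℝ) 1,
      HasDerivAt (fun x => H i x * linComb H' b x - H' i x * linComb H b x)
        (H i x * linComb H (fun j => (lam i - lam j) * b j) x) x := fun x hx => by
    have hd' := hasDerivAt_linComb (fun j => (hH j).hasDerivAt_snd x hx) b
    refine ((((hH i).hasDerivAt_fst x hx).mul hd').sub
      (((hH i).hasDerivAt_snd x hx).mul (hd x hx))).congr_deriv ?_
    have : ∑ j, b j * ((q x - lam j) * H j x) = (q x - lam i) * linComb H b x +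
        linComb H (fun j => (lam i - lam j) * b j) x := by
      simp only [linComb, Finset.mul_sum, ← Finset.sum_add_distrib]
      exact Finset.sum_congr rfl fun j _ => by ring
    rw [this]
    ring
  have hend : ∀ x, (∀ j, H j x = 0) → linComb H b x = 0 := fun x hx => by simp [linComb, hx]
  refine h.of_wronskian ((hH i).contDiffOn hq) (contDiffOn_linComb (fun j => (hH j).contDiffOn hq) b)
    hi (fun x hx => (hH i).hasDerivAt_fst x (Ioo_subset_Icc_self hx))
    (fun x hx => hd x (Ioo_subset_Icc_self hx)) (fun x _ => rfl)
    (fun x hx => (hw x hx).continuousAt.continuousWithinAt) ?_ ?_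
    (fun x hx => hw x (Ioo_subset_Icc_self hx))
  · simp [h0, hend 0 h0]
  · simp [h1, hend 1 h1]

lemma hasZeros_linComb_sub_pow_mul (hq : ContDiffOn ℝ ∞ q (Ioo 0 1))
    (hH : ∀ i, IsSolutionPair q (lam i) (H i) (H' i)) (h0 : ∀ i, H i 0 = 0) (h1 : ∀ i, H i 1 = 0)
    {i : Fin n} (hi : ∀ x ∈ Ioo (0 : ℝ) 1, H i x ≠ 0) {b : Fin n → ℝ} {N : ℕ}
    (h : HasZeros (linComb H b) N) (m : ℕ) :
    HasZeros (linComb H fun j => (lam i - lam j) ^ m * b j) N := by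
  induction m with
  | zero => simpa using h
  | succ m ih =>
    have := hasZeros_linComb_sub_mul hq hH h0 h1 hi ih
    simpa only [pow_succ', mul_assoc] using this

/-- A nontrivial linear combination of the first `n` eigenfunctions has fewer than `n` zeros in
`]0,1[`, counted with multiplicities. -/
theorem hasZeros_linComb_lt (hqc : ContinuousOn q (Icc 0 1)) (hq : ContDiffOn ℝ ∞ q (Ioo 0 1))
    (hlam : AreFirstEigenvalues q lam)
    (hH : ∀ i, IsSolutionPair q (lam i) (H i) (H' i)) (h0 : ∀ i, H i 0 = 0) (h1 : ∀ i, H i 1 = 0)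
    (hH' : ∀ i, H' i 0 ≠ 0) {b : Fin n → ℝ} (hb : b ≠ 0) {N : ℕ}
    (h : HasZeros (linComb H b) N) : N < n := by
  obtain ⟨J, hbJ, hJmax⟩ : ∃ J, b J ≠ 0 ∧ ∀ j, J < j → b j = 0 := by
    obtain ⟨j, hj⟩ := Function.ne_iff.1 hb
    have hne : (Finset.univ.filter fun j => b j ≠ 0).Nonempty := ⟨j, by simpa using hj⟩
    refine ⟨_, (Finset.mem_filter.1 (Finset.max'_mem _ hne)).2, fun k hk => ?_⟩
    by_contra hbk
    exact absurd (Finset.le_max' (Finset.univ.filter fun j => b j ≠ 0) k (by simpa using hbk))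
      (not_le.2 hk)
  have hn : 0 < n := J.pos
  let i₀ : Fin n := ⟨0, hn⟩
  have hi₀ : ∀ x ∈ Ioo (0 : ℝ) 1, H i₀ x ≠ 0 := fun x hx hx0 => by
    have := hlam.card_zeros_le hqc (hH i₀) (h0 i₀) (hH' i₀) (T := {x}) (by simpa using ⟨hx, hx0⟩)
    simp [i₀] at this
  suffices hNJ : N ≤ J from hNJ.trans_lt J.2
  -- The case `J = i₀` is direct; there the normalisation below would divide by 0.
  rcases eq_or_ne J i₀ with hJ | hJ
  · obtain ⟨T, k, hT, hN⟩ := h.exists_pos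
    have hTe : T = ∅ := Finset.eq_empty_of_forall_notMem fun c hc => by
      have hc0 : linComb H b c = 0 := by simpa using (hT c hc).2.2 0 (hT c hc).2.1
      have : linComb H b c = b J * H J c := Finset.sum_eq_single J (fun j _ hj => by
        have : J < j := by
          rw [hJ] at hj ⊢
          exact Fin.lt_def.2 (Nat.pos_of_ne_zero fun h => hj (Fin.ext h))
        rw [hJmax j this, zero_mul]) (by simp)
      rw [this, hJ] at hc0
      rw [hJ] at hbJ
      exact mul_ne_zero hbJ (hi₀ c (hT c hc).1) hc0
    rw [hTe, Finset.sum_empty] at hN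
    omega
  have hi₀J : i₀ < J := Fin.lt_def.2 (Nat.pos_of_ne_zero fun h => hJ (Fin.ext h))
  have hgap : 0 < lam J - lam i₀ := sub_pos.2 (hlam.strictMono hi₀J)
  -- Coefficients after `m` steps, scaled so that the `J`-th is 1. For `j < J` the ratio `(lam i₀ -
  -- lam j) / (lam i₀ - lam J)` lies in `[0,1[`, so the others tend to 0.
  let β : ℕ → Fin n → ℝ := fun m j =>
    ((lam i₀ - lam J) ^ m * b J)⁻¹ * ((lam i₀ - lam j) ^ m * b j)
  have hβz : ∀ m, HasZeros (linComb H (β m)) N := fun m => by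
    have hz := hasZeros_linComb_sub_pow_mul hq hH h0 h1 hi₀ h m
    refine (hz.mul_left (g := fun _ => ((lam i₀ - lam J) ^ m * b J)⁻¹) contDiffOn_const
      (contDiffOn_linComb (fun j => (hH j).contDiffOn hq) _)).congr fun x _ => ?_
    exact (linComb_smul H _ _ x).symm
  have hβ : ∀ j, Tendsto (fun m => β m j) atTop (𝓝 (if j = J then 1 else 0)) := by
    intro j
    have hne : lam i₀ - lam J ≠ 0 := by linarith
    have hβj : ∀ m, β m j = ((lam i₀ - lam j) / (lam i₀ - lam J)) ^ m * (b j / b J) := fun m => by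
      simp only [β, div_pow]
      field_simp
    simp only [hβj]
    rcases lt_trichotomy j J with hj | rfl | hj
    · rw [if_neg hj.ne, ← zero_mul (b j / b J)]
      refine (tendsto_pow_atTop_nhds_zero_of_lt_one ?_ ?_).mul_const _
      · have : lam i₀ ≤ lam j := hlam.strictMono.monotone (Fin.le_def.2 (Nat.zero_le _))
        exact div_nonneg_of_nonpos (by linarith) (by linarith)
      · have := hlam.strictMono hj
        rw [div_lt_one_of_neg (by linarith)]
        linarith
    · simp [div_self hne, div_self hbJ]
    · simp [hj.ne', hJmax j hj]
  have hlim : ∀ G : Fin n → ℝ → ℝ, (∀ j, ContinuousOn (G j) (Icc 0 1)) → ∀ x ∈ Icc (0 : ℝ) 1,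
      Tendsto (fun p : ℕ × ℝ => linComb G (β p.1) p.2) (atTop ×ˢ 𝓝[Icc 0 1] x) (𝓝 (G J x)) := by
    intro G hG x hx
    have : G J x = ∑ j, (if j = J then 1 else 0) * G j x := by simp
    rw [this]
    exact tendsto_finsetSum _ fun j _ =>
      ((hβ j).comp tendsto_fst).mul ((hG j x hx).tendsto.comp tendsto_snd)
  have hsimple := (hH J).snd_ne_zero_of_fst_eq_zero hqc (hH' J)
  have hlimH := hlim H fun j => (hH j).continuousOn_fst
  have hlimH' := hlim H' fun j => (hH j).continuousOn_snd
  have hcard : ∀ T : Finset ℝ, (∀ x ∈ T, x ∈ Icc (0 : ℝ) 1 ∧ H J x = 0) → T.card ≤ J + 2 := by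
    intro T hT
    have h2 := hlam.card_zeros_le hqc (hH J) (h0 J) (hH' J) (T := (T.erase 0).erase 1)
      fun x hx => by
        simp only [Finset.mem_erase] at hx
        obtain ⟨hx1, hx0, hxT⟩ := hx
        have hxI := (hT x hxT).1
        exact ⟨⟨lt_of_le_of_ne hxI.1 (Ne.symm hx0), lt_of_le_of_ne hxI.2 hx1⟩, (hT x hxT).2⟩
    have h3 := Finset.pred_card_le_card_erase (s := T) (a := 0)
    have h4 := Finset.pred_card_le_card_erase (s := T.erase 0) (a := 1)
    omega
  have hFd : ∀ m, ∀ x ∈ Icc (0 : ℝ) 1,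
      HasDerivAt (linComb H (β m)) (linComb H' (β m) x) x := fun m x hx =>
    hasDerivAt_linComb (fun j => (hH j).hasDerivAt_fst x hx) _
  obtain ⟨m, hm1, hm2⟩ := ((eventually_no_double_zero (F := fun m => linComb H (β m))
    (F' := fun m => linComb H' (β m)) hlimH hlimH' hsimple).and
    (eventually_card_zeros_le (F := fun m => linComb H (β m))
    (F' := fun m => linComb H' (β m)) hlimH hlimH' hFd hsimple hcard)).exists
  obtain ⟨T, k, hT, hN⟩ := (hβz m).exists_pos
  have hT0 : ∀ c ∈ T, linComb H (β m) c = 0 := fun c hc => by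
    simpa using (hT c hc).2.2 0 (hT c hc).2.1
  -- Without double zeros, multiplicities reduce to a plain count of points.
  have hk : ∀ c ∈ T, k c ≤ 1 := fun c hc => by
    by_contra! hkc
    have hcI := Ioo_subset_Icc_self (hT c hc).1
    refine hm1 c hcI (hT0 c hc) ?_
    have := (hT c hc).2.2 1 hkc
    rwa [iteratedDeriv_one, (hFd m c hcI).deriv] at this
  have hsum : ∑ c ∈ T, k c ≤ T.card := by
    simpa using Finset.sum_le_card_nsmul T k 1 hk
  have hend : ∀ x, (∀ j, H j x = 0) → linComb H (β m) x = 0 := fun x hx => by simp [linComb, hx]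
  -- The endpoints, zeros of every combination, absorb the `+ 2` in the bound `J + 2`.
  have h2 := hm2 (insert 0 (insert 1 T)) fun x hx => by
    simp only [Finset.mem_insert] at hx
    rcases hx with rfl | rfl | hx
    · exact ⟨left_mem_Icc.2 zero_le_one, hend 0 h0⟩
    · exact ⟨right_mem_Icc.2 zero_le_one, hend 1 h1⟩
    · exact ⟨Ioo_subset_Icc_self (hT x hx).1, hT0 x hx⟩
  have h0T : (0 : ℝ) ∉ T := fun h => lt_irrefl _ (hT 0 h).1.1
  have h1T : (1 : ℝ) ∉ T := fun h => lt_irrefl _ (hT 1 h).1.2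
  rw [Finset.card_insert_of_notMem (by simp [h0T]), Finset.card_insert_of_notMem h1T] at h2
  omega

end EigenfunctionSums

/-! ### The confluent Slater determinant -/

lemma hasZeros_of_injective {ι : Type*} [Fintype ι] {f : ℝ → ℝ} {c : ι → ℝ}
    (hc : Function.Injective c) (hcI : ∀ j, c j ∈ Ioo (0 : ℝ) 1) {k : ι → ℕ}
    (hk : ∀ j, ∀ m < k j, iteratedDeriv m f (c j) = 0) : HasZeros f (∑ j, k j) := by
  refine ⟨Finset.univ.map ⟨c, hc⟩, Function.extend c k 0, fun x hx => ?_, ?_⟩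
  · obtain ⟨j, -, rfl⟩ := Finset.mem_map.1 hx
    refine ⟨hcI j, fun m hm => hk j m ?_⟩
    simpa [hc.extend_apply] using hm
  · simp [Finset.sum_map, hc.extend_apply]

/-- If the coefficient vector `b` annihilates all columns of the confluent Slater determinant but
the last one, and if a coefficient vector that annihilates also `h x₀` vanishes, then `linComb h b`
is a nonzero multiple of the determinant. -/
lemma exists_linComb_eq_mul_confluentSlater {n p : ℕ} {h : Fin n → ℝ → ℝ} {c : Fin p → ℝ}
    {k : Fin p → ℕ} (hk : ∑ j, k j + 1 = n) {b : Fin n → ℝ}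
    (hb : ∀ j, ∀ m < k j, ∑ i, b i * iteratedDeriv m (h i) (c j) = 0)
    {x₀ : ℝ} (hbx₀ : linComb h b x₀ ≠ 0)
    (hx₀ : ∀ b' : Fin n → ℝ, (∀ j, ∀ m < k j, ∑ i, b' i * iteratedDeriv m (h i) (c j) = 0) →
      linComb h b' x₀ = 0 → b' = 0) :
    ∃ C : ℝ, C ≠ 0 ∧ ∀ x, linComb h b x = C * confluentSlater h c k hk x := by
  subst hk
  let M : ℝ → Matrix (Fin (∑ j, k j + 1)) (Fin (∑ j, k j + 1)) ℝ := fun x =>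
    Matrix.of fun i l => slaterColumn h c k x l i
  have hMlast : ∀ x i, M x i (Fin.last _) = h i x := fun x i => by
    simp [M, slaterColumn]
  have hMcast : ∀ x i l, M x i (Fin.castSucc l) =
      iteratedDeriv (finSigmaFinEquiv.symm l).2 (h i) (c (finSigmaFinEquiv.symm l).1) :=
    fun x i l => by simp [M, slaterColumn]
  have hMpair : ∀ x i j m, ∀ hm : m < k j,
      M x i (Fin.castSucc (finSigmaFinEquiv ⟨j, ⟨m, hm⟩⟩)) = iteratedDeriv m (h i) (c j) :=
    fun x i j m hm => by rw [hMcast, Equiv.symm_apply_apply]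
  have hdet : (M x₀).det ≠ 0 := by
    intro hzero
    obtain ⟨v, hv, hvM⟩ := Matrix.exists_vecMul_eq_zero_iff.2 hzero
    refine hv (hx₀ v (fun j m hm => ?_) ?_)
    · have := congrFun hvM (Fin.castSucc (finSigmaFinEquiv ⟨j, ⟨m, hm⟩⟩))
      simpa only [Matrix.vecMul, dotProduct, hMpair, Pi.zero_apply] using this
    · have := congrFun hvM (Fin.last _)
      simpa only [linComb, Matrix.vecMul, dotProduct, hMlast, Pi.zero_apply] using this
  -- Cofactors of the last column. They do not depend on `x`, as only that column does.
  let a : Fin (∑ j, k j + 1) → ℝ := fun i => (M x₀).adjugate (Fin.last _) i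
  have hslater : ∀ x, confluentSlater h c k rfl x = linComb h a x := by
    intro x
    have hM : M x = (M x₀).updateCol (Fin.last _) fun i => h i x := by
      ext i l
      refine Fin.lastCases ?_ (fun l => ?_) l
      · rw [hMlast, Matrix.updateCol_self]
      · rw [Matrix.updateCol_ne (Fin.castSucc_lt_last l).ne, hMcast, hMcast]
    have : confluentSlater h c k rfl x = (M x).det := rfl
    rw [this, hM, ← Matrix.cramer_apply, Matrix.cramer_eq_adjugate_mulVec]
    rfl
  have ha : ∀ j, ∀ m < k j, ∑ i, a i * iteratedDeriv m (h i) (c j) = 0 := by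
    intro j m hm
    have := congrFun (congrFun (Matrix.adjugate_mul (M x₀)) (Fin.last _))
      (Fin.castSucc (finSigmaFinEquiv ⟨j, ⟨m, hm⟩⟩))
    simp only [Matrix.mul_apply, hMpair] at this
    rw [this, Matrix.smul_apply, Matrix.one_apply_ne (Fin.castSucc_lt_last _).ne', smul_zero]
  have hax₀ : linComb h a x₀ = (M x₀).det := by
    rw [← hslater]
    rfl
  have hcomb : ∀ g : Fin (∑ j, k j + 1) → ℝ,
      ∑ i, ((M x₀).det * b i - linComb h b x₀ * a i) * g i =
        (M x₀).det * ∑ i, b i * g i - linComb h b x₀ * ∑ i, a i * g i := fun g => by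
    rw [Finset.mul_sum, Finset.mul_sum, ← Finset.sum_sub_distrib]
    exact Finset.sum_congr rfl fun i _ => by ring
  -- This combination of `b` and `a` is chosen to vanish at `x₀` as well, so it is zero and `b` is
  -- proportional to `a`.
  have hzero := hx₀ (fun i => (M x₀).det * b i - linComb h b x₀ * a i)
    (fun j m hm => by rw [hcomb, hb j m hm, ha j m hm]; ring)
    (by
      have h1 := hcomb fun i => h i x₀
      have h2 : ∑ i, a i * h i x₀ = (M x₀).det := hax₀
      have h3 : ∑ i, b i * h i x₀ = linComb h b x₀ := rfl
      rw [h2, h3] at h1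
      exact h1.trans (by ring))
  refine ⟨linComb h b x₀ / (M x₀).det, div_ne_zero hbx₀ hdet, fun x => ?_⟩
  have h1 := hcomb fun i => h i x
  have h2 : ∀ i, (M x₀).det * b i - linComb h b x₀ * a i = 0 := fun i => congrFun hzero i
  have h3 : ∑ i, a i * h i x = linComb h a x := rfl
  have h4 : ∑ i, b i * h i x = linComb h b x := rfl
  simp only [h2, zero_mul, Finset.sum_const_zero, h3, h4] at h1
  rw [hslater]
  field_simp
  linarith

end SturmLiouville

/-! ### The theorem -/

open SturmLiouville

theorem proposition6p4
    (q : ℝ → ℝ) (U : Set ℝ) (hU : IsOpen U) (hIU : Set.Icc (0 : ℝ) 1 ⊆ U)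
    (hq : ContDiffOn ℝ ∞ q U)
    (n : ℕ) (lam : Fin n → ℝ) (h : Fin n → ℝ → ℝ)
    (hlam : SturmLiouville.AreFirstEigenvalues q lam)
    (hh : ∀ i, SturmLiouville.IsDirichletEigenfunction q (lam i) (h i))
    (b : Fin n → ℝ) (hb : b ≠ 0) :
    ∃ (p : ℕ) (c : Fin p → ℝ) (k : Fin p → ℕ),
      StrictMono c ∧
      Set.range c = {x | x ∈ Set.Ioo (0 : ℝ) 1 ∧ SturmLiouville.linComb h b x = 0} ∧
      (∀ j, SturmLiouville.HasVanishingOrder (SturmLiouville.linComb h b) (c j) (k j)) ∧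
      ∑ j, k j ≤ n - 1 ∧
      (∀ hk : ∑ j, k j + 1 = n, ∃ C : ℝ, C ≠ 0 ∧
        ∀ x ∈ Set.Icc (0 : ℝ) 1,
          SturmLiouville.linComb h b x = C * SturmLiouville.confluentSlater h c k hk x) := by
  have hqc : ContinuousOn q (Set.Icc 0 1) := hq.continuousOn.mono hIU
  have hqs : ContDiffOn ℝ ∞ q (Set.Ioo 0 1) := hq.mono (Set.Ioo_subset_Icc_self.trans hIU)
  choose H H' hH hHh using fun i => (hh i).exists_isSolutionPair hqc
  have h0I : (0 : ℝ) ∈ Set.Icc (0 : ℝ) 1 := Set.left_mem_Icc.2 zero_le_one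
  have h1I : (1 : ℝ) ∈ Set.Icc (0 : ℝ) 1 := Set.right_mem_Icc.2 zero_le_one
  have hH0 : ∀ i, H i 0 = 0 := fun i => (hHh i h0I).trans (hh i).boundary_zero
  have hH1 : ∀ i, H i 1 = 0 := fun i => (hHh i h1I).trans (hh i).boundary_one
  have hH' : ∀ i, H' i 0 ≠ 0 := fun i hzero => by
    obtain ⟨x, hx, hxne⟩ := (hh i).nontrivial
    have hxI := Set.Ioo_subset_Icc_self hx
    rw [← hHh i hxI] at hxne
    exact hxne ((hH i).eq_zero_of_double_zero hqc h0I (hH0 i) hzero x hxI).1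
  have hcount : ∀ b : Fin n → ℝ, b ≠ 0 → ∀ N, HasZeros (linComb h b) N → N < n :=
    fun b hb N hN => hasZeros_linComb_lt hqc hqs hlam hH hH0 hH1 hH' hb <| hN.congr fun x hx =>
      Finset.sum_congr rfl fun j _ => by rw [hHh j (Set.Ioo_subset_Icc_self hx)]
  have hsm : ∀ i, ContDiffOn ℝ ∞ (h i) (Set.Ioo 0 1) := fun i =>
    ((hH i).contDiffOn hqs).congr fun x hx => (hHh i (Set.Ioo_subset_Icc_self hx)).symm
  have hiter : ∀ b : Fin n → ℝ, ∀ x ∈ Set.Ioo (0 : ℝ) 1, ∀ m,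
      iteratedDeriv m (linComb h b) x = ∑ j, b j * iteratedDeriv m (h j) x := fun b x hx m =>
    iteratedDeriv_linComb (fun i => ((contDiffOn_infty.1 (hsm i) m).contDiffAt
      (isOpen_Ioo.mem_nhds hx))) b
  -- Infinitely many zeros, or below a zero of infinite order, would give `n` zeros.
  have hfin : {x | x ∈ Set.Ioo (0 : ℝ) 1 ∧ linComb h b x = 0}.Finite := by
    by_contra hinf
    obtain ⟨T, hT, hcard⟩ := Set.Infinite.exists_subset_card_eq hinf n
    refine lt_irrefl n (hcount b hb n ⟨T, fun _ => 1, fun c hc => ⟨(hT hc).1, fun m hm => ?_⟩, ?_⟩)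
    · rw [Nat.lt_one_iff.1 hm, iteratedDeriv_zero]
      exact (hT hc).2
    · simp [hcard]
  have horder : ∀ x ∈ Set.Ioo (0 : ℝ) 1, ∃ m, HasVanishingOrder (linComb h b) x m := by
    intro x hx
    have hex : ∃ m, iteratedDeriv m (linComb h b) x ≠ 0 := by
      by_contra! hall
      exact lt_irrefl n (hcount b hb n ⟨{x}, fun _ => n, fun c hc => by
        rw [Finset.mem_singleton.1 hc]
        exact ⟨hx, fun m _ => hall m⟩, by simp⟩)
    classical
    exact ⟨Nat.find hex, fun m hm => not_not.1 (Nat.find_min hex hm), Nat.find_spec hex⟩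
  let c := hfin.toFinset.orderEmbOfFin rfl
  have hrange : Set.range c = {x | x ∈ Set.Ioo (0 : ℝ) 1 ∧ linComb h b x = 0} := by
    rw [Finset.range_orderEmbOfFin, Set.Finite.coe_toFinset]
  have hc : ∀ j, c j ∈ Set.Ioo (0 : ℝ) 1 ∧ linComb h b (c j) = 0 := fun j =>
    (Set.ext_iff.1 hrange (c j)).1 ⟨j, rfl⟩
  choose k hk using fun j => horder (c j) (hc j).1
  refine ⟨_, c, k, c.strictMono, hrange, hk, ?_, fun hkn => ?_⟩
  · have := hcount b hb _ (hasZeros_of_injective c.injective (fun j => (hc j).1)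
      fun j => (hk j).1)
    omega
  · obtain ⟨x₀, hx₀, hx₀T⟩ := (Set.Ioo_infinite (zero_lt_one' ℝ)).exists_notMem_finite hfin
    have hbx₀ : linComb h b x₀ ≠ 0 := fun hzero => hx₀T ⟨hx₀, hzero⟩
    obtain ⟨C, hC, hCx⟩ := exists_linComb_eq_mul_confluentSlater (h := h) hkn (b := b)
      (fun j m hm => by rw [← hiter b _ (hc j).1]; exact (hk j).1 m hm) hbx₀
      (fun b' hb' hb'x₀ => by
        by_contra hne
        -- Adding `x₀` as a simple zero (`none`) to the points `c j` raises the multiplicity from `n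
        -- - 1` to `n`, contradicting the count.
        have hinj : Function.Injective fun o : Option (Fin _) => o.elim x₀ c := by
          rintro (_ | i) (_ | j) hij
          · rfl
          · have hij' : x₀ = c j := hij
            exact absurd (hij' ▸ hc j) hx₀T
          · have hij' : c i = x₀ := hij
            exact absurd (hij' ▸ hc i) hx₀T
          · exact congrArg some (c.injective hij)
        have := hcount b' hne _ (hasZeros_of_injective hinj (k := fun o => o.elim 1 k)
          (by rintro (_ | j); exacts [hx₀, (hc j).1])
          (by
            rintro (_ | j) m hm
            · rw [Nat.lt_one_iff.1 hm, iteratedDeriv_zero]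
              exact hb'x₀
            · exact (hiter b' _ (hc j).1 m).trans (hb' j m hm)))
        rw [Fintype.sum_option] at this
        simp only [Option.elim] at this
        omega)
    exact ⟨C, hC, fun x _ => hCx x⟩
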